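/- **Model.** $K\ge 1$ sensors observe $y^k_t = x h^k_t + w^k_t$, $t=1,2,\dots$, where $x\in\mathbb C$ is a fixed parameter, the gains $h^k_t\in\mathbb C$ are random and, for each $k$, i.i.d. in $t$, and the $w^k_t\sim\mathcal N_c(0,\sigma_k^2)$ ($\sigma_k>0$) are circular complex Gaussian, independent across $k,t$ and independent of all gains. Put $$U^k_t=\sum_{\tau\le t}\frac{2|h^k_\tau|^2}{\sigma_k^2},\qquad V^k_t=\sum_{\tau\le t}\frac{2\Re(\overline{h^k_\tau}\,y^k_\tau)}{\sigma_k^2},\qquad U_t=\sum_k U_t^k .$$ $U_t$ is the conditional Fisher information $I^c_t$ for $\Re x$ given the gains $\mathcal H_t=\{h^k_\tau\}_{\tau\le t,\,k}$. **Estimator LT-dsDMLE with target information $\mathcal I$.** The parameters are thresholds $d_k,e_k$, quantizer ranges $\phi_k,\theta_k>0$ and bit numbers $r_V,r_U$; all may depend on $\mathcal I$. For $L>0$ and $b\in\mathbb N$ let $Q_{L,b}$ be the quantizer that divides $[0,L]$ into $2^b$ equal cells and maps a value to the midpoint of its cell, and a value outside $[0,L]$ to the closest such midpoint. Sensor $k$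 sends messages at the times $t^k_{0,V}=0$, $t^k_{n,V}=\min\{t>t^k_{n-1,V}:|V^k_t-V^k_{t^k_{n-1,V}}|\ge d_k\}$ and $t^k_{0,U}=0$, $t^k_{n,U}=\min\{t>t^k_{n-1,U}:U^k_t-U^k_{t^k_{n-1,U}}\ge e_k\}$. Let $v^k_n,u^k_n$ be the increments of $V^k,U^k$ over the $n$-th sampling interval, $q^k_n=|v^k_n|-d_k$, $p^k_n=u^k_n-e_k$, $\tilde q^k_n=Q_{\phi_k,r_V-1}(q^k_n)$, $\tilde p^k_n=Q_{\theta_k,r_U}(p^k_n)$. The fusion center computes $$\tilde V_t=\sum_k\sum_{n:\,1\le n,\ t^k_{n,V}\le t}\operatorname{sign}(v^k_n)(d_k+\tilde q^k_n),\qquad \tilde U_t=\sum_k\sum_{n:\,1\le n,\ t^k_{n,U}\le t}(e_k+\tilde p^k_n),$$ stops at $\tilde{\mathcal T}=\min\{t:\tilde U_t\ge\mathcal I\}$ and outputs the estimate $\tilde x_{\tilde{\mathcal T}}=\tilde V_{\tilde{\mathcal T}}/\tilde U_{\tilde{\mathcal T}}$ of $\Re x$. For all sufficiently large $\mathcal I$,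 the quantizer ranges are chosen such that, for all $k$ and $n\ge1$, $$\mathsf E|\tilde q^k_n-q^k_n|\le \phi_k 2^{-r_V},\qquad \mathsf E|\tilde p^k_n-p^k_n|\le \theta_k 2^{-(r_U+1)},$$ and they grow subexponentially in the number of bits: $\phi_k=O(2^{\varepsilon r_V})$ and $\theta_k=O(2^{\varepsilon r_U})$ as $\mathcal I\to\infty$ for every $\varepsilon>0$ (for instance, they are bounded). **Theorem.** Assume (A1) $\Re x\ne0$, $\Im x\ne 0$, and (A2) $h^k_t\ne0$ almost surely for all $k,t$. Suppose that, as $\mathcal I\to\infty$ and for all $k$, $d_k>0$, $d_k=o(\sqrt{\mathcal I})$, $r_V=\omega(\log(\sqrt{\mathcal I}/d_k))$, $e_k\to\infty$, $e_k=o(\sqrt{\mathcal I})$ and $r_U=\omega(\log(\sqrt{\mathcal I}/e_k))$. Then $\tilde{\mathcal T}<\infty$ almost surely for all sufficiently large $\mathcal I$, and LT-dsDMLE is asymptotically optimal: as $\mathcal I\to\infty$, $$Z_{\mathcal I}:=\sqrt{I^c_{\tilde{\mathcal T}}}\,\bigl(\tilde x_{\tilde{\mathcal T}}-\Re x\bigr)\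 \overset{d}{\longrightarrow}\ \mathcal N(0,1),$$ and this also holds given the observed gains $\mathcal H_{\tilde{\mathcal T}}$, in the sense that $\mathsf E[f(Z_{\mathcal I})\mid\mathcal H_{\tilde{\mathcal T}}]\to\int f\,d\mathcal N(0,1)$ in probability for every bounded continuous $f:\mathbb R\to\mathbb R$. -/

import Mathlib

open MeasureTheory ProbabilityTheory Filter Topology Asymptotics
open scoped ENNReal BoundedContinuousFunction

namespace LevelTriggered

noncomputable section

/-- The circularly symmetric complex Gaussian law of mean zero and variance `v`: the real and
imaginary parts are independent real Gaussians of mean `0` and variance `v / 2`. -/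
def complexGaussian (v : ℝ) : Measure ℂ :=
  ((gaussianReal 0 (v / 2).toNNReal).prod (gaussianReal 0 (v / 2).toNNReal)).map
    (fun p : ℝ × ℝ => (⟨p.1, p.2⟩ : ℂ))

/-! ### Local processes of one sensor

Time runs through `1, 2, 3, …`; the sample taken at time `t` is stored at index `t - 1`, so that
a sum over the times `1, …, t` is a sum over `Finset.range t`. The parameter `v` is the variance
of the noise of the sensor. -/

/-- `V_t = ∑_{τ ≤ t} 2 Re (conj (h_τ) y_τ) / v`. -/
def corr (v : ℝ) (h y : ℕ → ℂ) (t : ℕ) : ℝ :=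
  ∑ i ∈ Finset.range t, 2 * (starRingEnd ℂ (h i) * y i).re / v

/-- `U_t = ∑_{τ ≤ t} 2 |h_τ|² / v`. -/
def info (v : ℝ) (h : ℕ → ℂ) (t : ℕ) : ℝ :=
  ∑ i ∈ Finset.range t, 2 * ‖h i‖ ^ 2 / v

/-! ### Level-triggered sampling -/

/-- Sampling times of the path `Z`: `t_0 = 0`, and `t_{n+1}` is the first time `t > t_n` at which
the increment `Z t - Z t_n` lies in the set `B` (`⊤` if this never happens). -/
def sampleTime (B : Set ℝ) (Z : ℕ → ℝ) : ℕ → ℕ∞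
  | 0 => 0
  | n + 1 => sInf ((fun t : ℕ => (t : ℕ∞)) ''
      {t : ℕ | sampleTime B Z n < (t : ℕ∞) ∧ Z t - Z (sampleTime B Z n).toNat ∈ B})

/-- The increment of `Z` between the sampling times `t_{n-1}` and `t_n`, for `n ≥ 1`. -/
def sampleIncr (B : Set ℝ) (Z : ℕ → ℝ) (n : ℕ) : ℝ :=
  Z (sampleTime B Z n).toNat - Z (sampleTime B Z (n - 1)).toNat

/-- The number of sampling times among `1, …, t`. -/
def numMessages (B : Set ℝ) (Z : ℕ → ℝ) (t : ℕ) : ℕ :=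
  Set.ncard {n : ℕ | 1 ≤ n ∧ sampleTime B Z n ≤ (t : ℕ∞)}

/-- Mid-riser uniform quantizer: `[0, L]` is split into `2 ^ b` cells of equal length, a value is
mapped to the midpoint of its cell, a value outside `[0, L]` to the closest midpoint. -/
def midRiser (L : ℝ) (b : ℕ) (p : ℝ) : ℝ :=
  L / 2 ^ b * (((min ⌊p / (L / 2 ^ b)⌋₊ (2 ^ b - 1) : ℕ) : ℝ) + 1 / 2)

/-! ### The estimator -/

/-- Design parameters of the scheme with `K` sensors: the thresholds `d k` for `V` and `e k` for
`U`, the ranges `φ k` and `θ k` of the overshoot quantizers, and the numbers `rV`, `rU` of bits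
per message. -/
structure Design (K : ℕ) where
  d : Fin K → ℝ
  e : Fin K → ℝ
  φ : Fin K → ℝ
  θ : Fin K → ℝ
  rV : ℕ
  rU : ℕ

/-- Increments that trigger a message about `V`. -/
def trigV (d : ℝ) : Set ℝ := (Set.Ioo (-d) d)ᶜ

/-- Increments that trigger a message about `U`. -/
def trigU (e : ℝ) : Set ℝ := Set.Ici e

/-- Overshoot `q_n = |v_n| - d` of the `n`-th message about the path `V`. -/
def overV (d : ℝ) (V : ℕ → ℝ) (n : ℕ) : ℝ := |sampleIncr (trigV d) V n| - d

/-- Overshoot `p_n = u_n - e` of the `n`-th message about the path `U`. -/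
def overU (e : ℝ) (U : ℕ → ℝ) (n : ℕ) : ℝ := sampleIncr (trigU e) U n - e

/-- `∑_{n ≤ N_t} sign (v_n) (d + q̃_n)`, where one of the `r` bits carries the sign and the
overshoot is quantized with the other `r - 1` bits. -/
def approxV (d φ : ℝ) (r : ℕ) (V : ℕ → ℝ) (t : ℕ) : ℝ :=
  ∑ n ∈ Finset.Icc 1 (numMessages (trigV d) V t),
    Real.sign (sampleIncr (trigV d) V n) * (d + midRiser φ (r - 1) (overV d V n))

/-- `∑_{n ≤ M_t} (e + p̃_n)`, where the overshoot is quantized with all `r` bits. -/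
def approxU (e θ : ℝ) (r : ℕ) (U : ℕ → ℝ) (t : ℕ) : ℝ :=
  ∑ n ∈ Finset.Icc 1 (numMessages (trigU e) U t), (e + midRiser θ r (overU e U n))

variable {K : ℕ}

/-- The approximation of `V_t` at the fusion center. -/
def fusionV (D : Design K) (σ : Fin K → ℝ) (h y : Fin K → ℕ → ℂ) (t : ℕ) : ℝ :=
  ∑ k, approxV (D.d k) (D.φ k) D.rV (corr (σ k ^ 2) (h k) (y k)) t

/-- The approximation of `U_t` at the fusion center. -/
def fusionU (D : Design K) (σ : Fin K → ℝ) (h : Fin K → ℕ → ℂ) (t : ℕ) : ℝ :=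
  ∑ k, approxU (D.e k) (D.θ k) D.rU (info (σ k ^ 2) (h k)) t

/-- The stopping time: the first `t` at which the fusion center's approximation of `U_t` reaches
the target `target`. -/
def stopTime (D : Design K) (σ : Fin K → ℝ) (target : ℝ) (h : Fin K → ℕ → ℂ) : ℕ :=
  sInf {t : ℕ | target ≤ fusionU D σ h t}

/-- The final estimate of `Re x`. -/
def estimate (D : Design K) (σ : Fin K → ℝ) (target : ℝ) (h y : Fin K → ℕ → ℂ) : ℝ :=
  fusionV D σ h y (stopTime D σ target h) / fusionU D σ h (stopTime D σ target h)

/-- The conditional Fisher information `∑_k U_t^k` given the channel gains up to time `t`. -/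
def fisherInfo (σ : Fin K → ℝ) (h : Fin K → ℕ → ℂ) (t : ℕ) : ℝ :=
  ∑ k, info (σ k ^ 2) (h k) t

/-- The observations `y = x h + w`. -/
def observe (x : ℂ) (h w : Fin K → ℕ → ℂ) : Fin K → ℕ → ℂ :=
  fun k i => x * h k i + w k i

/-- The normalized error of the final estimate of `Re x`: the square root of the conditional
Fisher information at the stopping time, times the error. -/
def normalizedError (D : Design K) (σ : Fin K → ℝ) (target : ℝ) (x : ℂ)
    (h w : Fin K → ℕ → ℂ) : ℝ :=
  √(fisherInfo σ h (stopTime D σ target h)) *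
    (estimate D σ target h (observe x h w) - x.re)

/-- The σ-algebra generated by the channel gains observed up to the stopping time. -/
@[reducible] def gainsUpToStop {Ω : Type*} (D : Design K) (σ : Fin K → ℝ) (target : ℝ)
    (h : Ω → Fin K → ℕ → ℂ) : MeasurableSpace Ω :=
  MeasurableSpace.comap
    (fun ω => (stopTime D σ target (h ω),
      fun (k : Fin K) (i : ℕ) => if i < stopTime D σ target (h ω) then h ω k i else 0))
    inferInstance

end

end LevelTriggered

open LevelTriggered

/-! Write `T` for the target, `τ` for the stopping time, `U` for the Fisher information and `V = Re
x · U + M`, with `M` the noise score. Since `τ` depends on the gains alone, conditioning on all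
gains freezes both `τ` and `U_τ`. A Gaussian linear form then gives `M_τ` the conditional law `N(0,
U_τ)`. Hence `G = M_τ / √U_τ` is exactly standard normal and independent of the gains
(`map_gains_normalizedScore`). No martingale limit theorem is needed.

It remains to show `Z - G → 0` in probability, where `Z` is the normalized error. An algebraic
inequality (`abs_sqrt_mul_div_sub_sub_div_sqrt_le`) reduces this to showing that the fusion center's
errors in `U_τ` and `V_τ` are `o(√T)`. Each error is an unsent remainder, at most a threshold and
hence `o(√T)`, plus the accumulated quantization errors of the messages.

The number of messages is random and may depend on the quantization errors. It is therefore
replaced, on an event of high probability, by the deterministic `⌊ρ² √T⌋`, where `ρ` is `√T / d` or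
`√T / e`. For `U`, each message adds at least `e` to a sum that stays below `T` before stopping. For
`V`, each message uses up variation at least `d`, and the variation up to a time of order `T` is
`O(T)` in probability, hence below `T ρ`. Markov's inequality bounds the accumulated error, because
`2 ^ r` eventually dominates every power of `ρ` (`tendsto_sq_mul_range_div_pow`). The law of large
numbers bounds `τ` by a multiple of `T`. The finite mean of `‖h‖²` that it requires follows from the
quantizer bound for the first message (`first_increment_le`).

Slutsky's theorem then gives the limit law. For the conditional statement, conditional expectation
contracts `L¹`, and `f(G)` has constant conditional expectation. -/

namespace LevelTriggered

/-! ### Combinatorics of level-triggered sampling times -/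

section Sampling

variable {B : Set ℝ} {Z : ℕ → ℝ}

lemma sampleTime_succ_eq_coe_iff {n t : ℕ} :
    sampleTime B Z (n + 1) = t ↔
      sampleTime B Z n < t ∧ Z t - Z (sampleTime B Z n).toNat ∈ B ∧
        ∀ i < t, sampleTime B Z n < (i : ℕ∞) → Z i - Z (sampleTime B Z n).toNat ∉ B := by
  rw [sampleTime]
  constructor
  · intro h
    set S := {t : ℕ | sampleTime B Z n < (t : ℕ∞) ∧ Z t - Z (sampleTime B Z n).toNat ∈ B}
    have hne : ((fun t : ℕ => (t : ℕ∞)) '' S).Nonempty := by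
      by_contra hS
      rw [Set.not_nonempty_iff_eq_empty] at hS
      rw [hS, sInf_empty] at h
      exact ENat.natCast_ne_top t h.symm
    obtain ⟨j, hj, hjt⟩ := csInf_mem hne
    rw [h] at hjt
    have hjt : j = t := Nat.cast_injective hjt
    subst hjt
    refine ⟨hj.1, hj.2, fun i hi h1 h2 => ?_⟩
    have := sInf_le (Set.mem_image_of_mem (fun t : ℕ => (t : ℕ∞)) (show i ∈ S from ⟨h1, h2⟩))
    rw [h] at this
    have : j ≤ i := by exact_mod_cast this
    omega
  · rintro ⟨h1, h2, h3⟩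
    apply le_antisymm
    · exact sInf_le (Set.mem_image_of_mem _ ⟨h1, h2⟩)
    · refine le_sInf ?_
      rintro _ ⟨i, ⟨hi1, hi2⟩, rfl⟩
      by_contra hlt
      have : i < t := by
        have : (i : ℕ∞) < t := not_le.1 hlt
        exact_mod_cast this
      exact h3 i this hi1 hi2

lemma sampleTime_lt_succ {n t : ℕ} (h : sampleTime B Z (n + 1) ≤ t) :
    sampleTime B Z n < sampleTime B Z (n + 1) := by
  obtain ⟨j, hj⟩ := ENat.ne_top_iff_exists.1 (ne_top_of_le_ne_top (ENat.natCast_ne_top t) h)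
  rw [← hj]
  exact (sampleTime_succ_eq_coe_iff.1 hj.symm).1

lemma sampleTime_mono : Monotone (sampleTime B Z) := by
  refine monotone_nat_of_le_succ fun n => ?_
  by_cases h : sampleTime B Z (n + 1) = ⊤
  · rw [h]; exact le_top
  · obtain ⟨j, hj⟩ := ENat.ne_top_iff_exists.1 h
    exact (sampleTime_lt_succ hj.ge).le

lemma le_sampleTime (n : ℕ) : (n : ℕ∞) ≤ sampleTime B Z n := by
  induction n with
  | zero => simp
  | succ n ih =>
    by_cases h : sampleTime B Z (n + 1) = ⊤
    · rw [h]; exact le_top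
    · obtain ⟨j, hj⟩ := ENat.ne_top_iff_exists.1 h
      have := lt_of_le_of_lt ih (sampleTime_lt_succ hj.ge)
      rw [← hj] at this ⊢
      have : n < j := by exact_mod_cast this
      exact_mod_cast this

/-- Sampling times are nondecreasing and the `n`-th is at least `n`, so the indices sampled by time
`t` form a finite initial segment. This turns statements about counts into statements about times.
-/
lemma le_numMessages_iff {n t : ℕ} : n ≤ numMessages B Z t ↔ sampleTime B Z n ≤ t := by
  classical
  have hex : ∃ m : ℕ, ∀ n, sampleTime B Z n ≤ t ↔ n ≤ m := by
    refine ⟨Nat.findGreatest (fun n => sampleTime B Z n ≤ t) t, fun n => ⟨fun h => ?_, fun h => ?_⟩⟩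
    · refine Nat.le_findGreatest ?_ h
      exact_mod_cast (le_sampleTime n).trans h
    · have h0 : sampleTime B Z 0 ≤ t := by simp [sampleTime]
      exact (sampleTime_mono h).trans
        (Nat.findGreatest_spec (P := fun n => sampleTime B Z n ≤ t) (Nat.zero_le t) h0)
  obtain ⟨m, hm⟩ := hex
  have : numMessages B Z t = m := by
    have : {n : ℕ | 1 ≤ n ∧ sampleTime B Z n ≤ (t : ℕ∞)} = ↑(Finset.Icc 1 m) := by
      ext n; simp [hm]
    rw [numMessages, this, Set.ncard_coe_finset, Nat.card_Icc]
    omega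
  rw [this, hm]

lemma numMessages_le (t : ℕ) : numMessages B Z t ≤ t := by
  have := (le_sampleTime _).trans (le_numMessages_iff.1 (le_refl (numMessages B Z t)))
  exact_mod_cast this

lemma numMessages_succ_le (t : ℕ) : numMessages B Z (t + 1) ≤ numMessages B Z t + 1 := by
  by_contra! h
  have h2 := le_numMessages_iff.1 (show numMessages B Z t + 1 + 1 ≤ numMessages B Z (t + 1) from h)
  have h3 := lt_of_lt_of_le (sampleTime_lt_succ h2) h2
  obtain ⟨j, hj⟩ := ENat.ne_top_iff_exists.1 (ne_top_of_lt h3)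
  rw [← hj] at h3
  have h4 : j ≤ t := by
    have : j < t + 1 := by exact_mod_cast h3
    omega
  have h5 := le_numMessages_iff.2 (show sampleTime B Z (numMessages B Z t + 1) ≤ t by
    rw [← hj]; exact_mod_cast h4)
  omega

lemma sub_lastSample_notMem (h0 : (0 : ℝ) ∉ B) (t : ℕ) :
    Z t - Z (sampleTime B Z (numMessages B Z t)).toNat ∉ B := by
  set m := numMessages B Z t with hm
  have h1 : sampleTime B Z m ≤ t := le_numMessages_iff.1 le_rfl
  have h2 : ¬ sampleTime B Z (m + 1) ≤ t := fun h => by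
    have := le_numMessages_iff.2 h
    omega
  rcases h1.eq_or_lt with h | h
  -- If `t` is itself the last sampling time, the increment is `0`; this is where `0 ∉ B` enters.
  · rw [h]; simpa using h0
  · intro hmem
    exact h2 (sInf_le (Set.mem_image_of_mem (fun t : ℕ => (t : ℕ∞)) ⟨h, hmem⟩))

lemma sum_sampleIncr (m : ℕ) :
    ∑ n ∈ Finset.Icc 1 m, sampleIncr B Z n = Z (sampleTime B Z m).toNat - Z 0 := by
  induction m with
  | zero => simp [sampleTime]
  | succ m ih =>
    rw [Finset.sum_Icc_succ_top (by omega), ih, sampleIncr]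
    simp

/-- Between consecutive samples the path moves by at least `d`, so every message uses up that much
total variation. -/
lemma mul_numMessages_le_variation {d : ℝ} (hB : ∀ z ∈ B, d ≤ |z|) (t : ℕ) :
    d * numMessages B Z t ≤ ∑ i ∈ Finset.range t, |Z (i + 1) - Z i| := by
  have key : ∀ n : ℕ, ∀ j : ℕ, sampleTime B Z n = j →
      d * n ≤ ∑ i ∈ Finset.range j, |Z (i + 1) - Z i| := by
    intro n
    induction n with
    | zero => intro j _; simpa using Finset.sum_nonneg fun i _ => abs_nonneg (Z (i + 1) - Z i)
    | succ n ih =>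
      intro j hj
      obtain ⟨h1, h2, -⟩ := sampleTime_succ_eq_coe_iff.1 hj
      obtain ⟨i, hi⟩ := ENat.ne_top_iff_exists.1 (ne_top_of_lt h1)
      rw [← hi] at h1 h2
      have hij : i ≤ j := by
        have : i < j := by exact_mod_cast h1
        omega
      have h3 := hB _ h2
      rw [ENat.toNat_natCast, ← Finset.sum_Ico_sub Z hij] at h3
      have h4 := h3.trans (Finset.abs_sum_le_sum_abs _ _)
      rw [← Finset.sum_range_add_sum_Ico _ hij]
      have := ih i hi.symm
      push_cast
      linarith
  have h1 : sampleTime B Z (numMessages B Z t) ≤ t := le_numMessages_iff.1 le_rfl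
  obtain ⟨j, hj⟩ := ENat.ne_top_iff_exists.1 (ne_top_of_le_ne_top (ENat.natCast_ne_top t) h1)
  rw [← hj] at h1
  have hjt : j ≤ t := by exact_mod_cast h1
  refine (key _ j hj.symm).trans
    (Finset.sum_le_sum_of_subset_of_nonneg (Finset.range_subset_range.2 hjt) fun _ _ _ => abs_nonneg _)

lemma exists_le_numMessages {e : ℝ} (hZ : Tendsto Z atTop atTop) (n : ℕ) :
    ∃ t, n ≤ numMessages (trigU e) Z t := by
  simp_rw [le_numMessages_iff]
  induction n with
  | zero => exact ⟨0, by simp [sampleTime]⟩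
  | succ n ih =>
    obtain ⟨t, ht⟩ := ih
    obtain ⟨j, hj⟩ := ENat.ne_top_iff_exists.1 (ne_top_of_le_ne_top (ENat.natCast_ne_top t) ht)
    obtain ⟨i, hi1, hi2⟩ := ((eventually_gt_atTop j).and
      (hZ.eventually_ge_atTop (e + Z j))).exists
    refine ⟨i, ?_⟩
    rw [sampleTime]
    refine sInf_le (Set.mem_image_of_mem (fun t : ℕ => (t : ℕ∞)) ⟨?_, ?_⟩)
    · rw [← hj]; exact_mod_cast hi1
    · rw [← hj, ENat.toNat_natCast]
      show e ≤ _
      linarith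

end Sampling

/-! ### Quantization errors and the reconstructed paths -/

section Quantizer

lemma midRiser_nonneg {L : ℝ} (hL : 0 ≤ L) (b : ℕ) (p : ℝ) : 0 ≤ midRiser L b p := by
  unfold midRiser; positivity

lemma midRiser_le {L : ℝ} (hL : 0 ≤ L) (b : ℕ) (p : ℝ) : midRiser L b p ≤ L := by
  unfold midRiser
  have h1 : ((min ⌊p / (L / 2 ^ b)⌋₊ (2 ^ b - 1) : ℕ) : ℝ) ≤ 2 ^ b - 1 := by
    have h : min ⌊p / (L / 2 ^ b)⌋₊ (2 ^ b - 1) ≤ 2 ^ b - 1 := min_le_right _ _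
    have h2 : ((2 ^ b - 1 : ℕ) : ℝ) = 2 ^ b - 1 := by
      rw [Nat.cast_sub Nat.one_le_two_pow]; simp
    rw [← h2]; exact_mod_cast h
  calc _ ≤ L / 2 ^ b * (2 ^ b - 1 + 1 / 2) := by gcongr
    _ ≤ L / 2 ^ b * 2 ^ b := by gcongr; linarith
    _ = L := by field_simp

/-- The total quantization error of the first `m` messages about `V`. -/
noncomputable def quantErrorV (d φ : ℝ) (r : ℕ) (V : ℕ → ℝ) (m : ℕ) : ℝ :=
  ∑ n ∈ Finset.Icc 1 m, |midRiser φ (r - 1) (overV d V n) - overV d V n|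

/-- The total quantization error of the first `m` messages about `U`. -/
noncomputable def quantErrorU (e θ : ℝ) (r : ℕ) (U : ℕ → ℝ) (m : ℕ) : ℝ :=
  ∑ n ∈ Finset.Icc 1 m, |midRiser θ r (overU e U n) - overU e U n|

lemma quantErrorV_mono (d φ : ℝ) (r : ℕ) (V : ℕ → ℝ) : Monotone (quantErrorV d φ r V) :=
  fun _ _ h => Finset.sum_le_sum_of_subset_of_nonneg (Finset.Icc_subset_Icc_right h)
    fun _ _ _ => abs_nonneg _

lemma quantErrorU_mono (e θ : ℝ) (r : ℕ) (U : ℕ → ℝ) : Monotone (quantErrorU e θ r U) :=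
  fun _ _ h => Finset.sum_le_sum_of_subset_of_nonneg (Finset.Icc_subset_Icc_right h)
    fun _ _ _ => abs_nonneg _

/-- The exact increments telescope to the path at its last sample. What is left is the unsent
increment, shorter than `d`, and one quantization error per message. -/
lemma abs_approxV_sub_le {d : ℝ} (hd : 0 < d) (φ : ℝ) (r : ℕ) {V : ℕ → ℝ} (hV : V 0 = 0) (t : ℕ) :
    |approxV d φ r V t - V t| ≤ d + quantErrorV d φ r V (numMessages (trigV d) V t) := by
  set m := numMessages (trigV d) V t with hm
  have h0 : (0 : ℝ) ∉ trigV d := by simp [trigV, hd]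
  have h1 := sub_lastSample_notMem (Z := V) h0 t
  rw [← hm] at h1
  have h2 : |V t - V (sampleTime (trigV d) V m).toNat| ≤ d := by
    have : V t - V (sampleTime (trigV d) V m).toNat ∈ Set.Ioo (-d) d := by
      simpa [trigV] using h1
    rw [abs_le]
    exact ⟨this.1.le, this.2.le⟩
  have h3 := sum_sampleIncr (B := trigV d) (Z := V) m
  rw [hV, sub_zero] at h3
  have h4 : |approxV d φ r V t - ∑ n ∈ Finset.Icc 1 m, sampleIncr (trigV d) V n| ≤
      quantErrorV d φ r V m := by
    rw [approxV, ← hm, ← Finset.sum_sub_distrib]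
    refine (Finset.abs_sum_le_sum_abs _ _).trans (Finset.sum_le_sum fun n hn => ?_)
    rw [overV]
    set v := sampleIncr (trigV d) V n
    set q := midRiser φ (r - 1) (|v| - d)
    have : Real.sign v * (d + q) - v = Real.sign v * (q - (|v| - d)) := by
      rcases lt_trichotomy v 0 with h | h | h
      · rw [Real.sign_of_neg h, abs_of_neg h]; ring
      · rw [h]; simp
      · rw [Real.sign_of_pos h, abs_of_pos h]; ring
    rw [this, abs_mul]
    have h5 : |Real.sign v| ≤ 1 := by
      rcases Real.sign_apply_eq v with h | h | h <;> rw [h] <;> simp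
    exact mul_le_of_le_one_left (abs_nonneg _) h5
  rw [h3] at h4
  calc _ = |(approxV d φ r V t - V (sampleTime (trigV d) V m).toNat)
      - (V t - V (sampleTime (trigV d) V m).toNat)| := by ring_nf
    _ ≤ _ := (abs_sub _ _).trans (by linarith)

lemma abs_approxU_sub_le {e : ℝ} (he : 0 < e) (θ : ℝ) (r : ℕ) {U : ℕ → ℝ} (hU : U 0 = 0)
    (hmono : Monotone U) (t : ℕ) :
    |approxU e θ r U t - U t| ≤ e + quantErrorU e θ r U (numMessages (trigU e) U t) := by
  set m := numMessages (trigU e) U t with hm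
  have h0 : (0 : ℝ) ∉ trigU e := by simp [trigU, he]
  have h1 := sub_lastSample_notMem (Z := U) h0 t
  rw [← hm] at h1
  have hle : (sampleTime (trigU e) U m).toNat ≤ t :=
    ENat.toNat_le_of_le_natCast (le_numMessages_iff.1 hm.le)
  have h2 : |U t - U (sampleTime (trigU e) U m).toNat| ≤ e := by
    have : U t - U (sampleTime (trigU e) U m).toNat < e := by
      simpa [trigU] using h1
    -- The trigger for `U` is one-sided; monotonicity supplies the lower bound on the unsent
    -- increment.
    rw [abs_of_nonneg (sub_nonneg.2 (hmono hle))]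
    exact this.le
  have h3 := sum_sampleIncr (B := trigU e) (Z := U) m
  rw [hU, sub_zero] at h3
  have h4 : |approxU e θ r U t - ∑ n ∈ Finset.Icc 1 m, sampleIncr (trigU e) U n| ≤
      quantErrorU e θ r U m := by
    rw [approxU, ← hm, ← Finset.sum_sub_distrib]
    refine (Finset.abs_sum_le_sum_abs _ _).trans (Finset.sum_le_sum fun n hn => ?_)
    rw [overU]
    exact le_of_eq (congrArg _ (by ring))
  rw [h3] at h4
  calc _ = |(approxU e θ r U t - U (sampleTime (trigU e) U m).toNat)
      - (U t - U (sampleTime (trigU e) U m).toNat)| := by ring_nf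
    _ ≤ _ := (abs_sub _ _).trans (by linarith)

lemma mul_numMessages_le_approxU {e θ : ℝ} (hθ : 0 ≤ θ) (r : ℕ) (U : ℕ → ℝ) (t : ℕ) :
    e * numMessages (trigU e) U t ≤ approxU e θ r U t := by
  have : ∑ n ∈ Finset.Icc 1 (numMessages (trigU e) U t), e = e * numMessages (trigU e) U t := by
    simp [mul_comm]
  rw [← this, approxU]
  exact Finset.sum_le_sum fun n _ => le_add_of_nonneg_right (midRiser_nonneg hθ _ _)

/-- Quantizer outputs never exceed `θ`, so a large first increment must show up as a large error of
the first message. Hence an integrable quantization error forces an integrable `U 1`. -/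
lemma first_increment_le {e θ : ℝ} (hθ : 0 ≤ θ) (r : ℕ) {U : ℕ → ℝ} (hU : U 0 = 0) :
    U 1 ≤ e + θ + |midRiser θ r (overU e U 1) - overU e U 1| := by
  rcases lt_or_ge (U 1) e with h | h
  · have := abs_nonneg (midRiser θ r (overU e U 1) - overU e U 1)
    linarith
  · have h1 : sampleTime (trigU e) U (0 + 1) = (1 : ℕ) := by
      rw [sampleTime_succ_eq_coe_iff]
      refine ⟨by simp [sampleTime], by simpa [sampleTime, hU, trigU] using h, fun i hi h2 => ?_⟩
      have : i = 0 := by omega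
      subst this
      simp [sampleTime] at h2
    have h2 : overU e U 1 = U 1 - e := by
      rw [overU, sampleIncr, h1]
      simp [sampleTime, hU]
    have h3 := midRiser_le hθ r (overU e U 1)
    have h4 := neg_abs_le (midRiser θ r (overU e U 1) - overU e U 1)
    rw [h2] at h3 h4 ⊢
    linarith

end Quantizer

/-! ### Measurability of the sampled quantities -/

section Measurability

variable {α : Type*} [MeasurableSpace α] {B : Set ℝ} {Z : α → ℕ → ℝ}

lemma measurable_apply_nat {β : Type*} [MeasurableSpace β] {F : ℕ → α → β}
    (hF : ∀ n, Measurable (F n)) {N : α → ℕ} (hN : Measurable N) :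
    Measurable fun a => F (N a) a := by
  have : Measurable fun p : ℕ × α => F p.1 p.2 := measurable_from_prod_countable_right hF
  exact this.comp (hN.prodMk measurable_id)

lemma measurable_nat_sInf {P : ℕ → α → Prop} (hP : ∀ n, MeasurableSet {a | P n a}) :
    Measurable fun a => sInf {n | P n a} := by
  classical
  refine measurable_of_Ici fun n => ?_
  have : (fun a => sInf {n | P n a}) ⁻¹' Set.Ici n =
      -- Since `sInf ∅ = 0`, a positive lower bound also requires that `P` hold somewhere.
      if n = 0 then Set.univ else (⋃ j, {a | P j a}) ∩ ⋂ j ∈ Finset.range n, {a | P j a}ᶜ := by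
    split_ifs with hn
    · subst hn; ext a; simp
    · ext a
      simp only [Set.mem_preimage, Set.mem_Ici, Set.mem_inter_iff, Set.mem_iUnion, Set.mem_ofPred_eq,
        Set.mem_iInter, Set.mem_compl_iff, Finset.mem_range]
      constructor
      · intro h
        have hne : {n | P n a}.Nonempty := Nat.nonempty_of_pos_sInf (by omega)
        exact ⟨hne, fun j hj hPj => by have := Nat.sInf_le (show j ∈ {n | P n a} from hPj); omega⟩
      · rintro ⟨hne, h⟩
        by_contra hlt
        exact h _ (not_le.1 hlt) (Nat.sInf_mem hne)
  rw [this]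
  split_ifs
  · exact MeasurableSet.univ
  · exact (MeasurableSet.iUnion hP).inter
      (Finset.measurableSet_biInter _ fun j _ => (hP j).compl)

lemma measurableSet_sampleTime_eq (hB : MeasurableSet B) (hZ : ∀ t, Measurable fun a => Z a t)
    (n t : ℕ) : MeasurableSet {a | sampleTime B (Z a) n = t} := by
  classical
  induction n generalizing t with
  | zero => simp [sampleTime]
  | succ n ih =>
    -- Splitting over the value `j < t` of the previous sampling time leaves conditions at finitely
    -- many fixed times.
    have : {a | sampleTime B (Z a) (n + 1) = t} =
        ⋃ j ∈ Finset.range t, {a | sampleTime B (Z a) n = j} ∩ ({a | Z a t - Z a j ∈ B} ∩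
          ⋂ i ∈ Finset.Ioo j t, {a | Z a i - Z a j ∈ B}ᶜ) := by
      ext a
      simp only [Set.mem_ofPred_eq, Set.mem_iUnion, Set.mem_inter_iff, Set.mem_iInter,
        Set.mem_compl_iff, Finset.mem_Ioo, Finset.mem_range]
      rw [sampleTime_succ_eq_coe_iff]
      constructor
      · rintro ⟨h1, h2, h3⟩
        obtain ⟨j, hj⟩ := ENat.ne_top_iff_exists.1 (ne_top_of_lt h1)
        rw [← hj] at h1 h2 h3
        rw [ENat.toNat_natCast] at h2 h3
        exact ⟨j, by exact_mod_cast h1, hj.symm, h2, fun i hi => h3 i hi.2 (by exact_mod_cast hi.1)⟩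
      · rintro ⟨j, h1, h2, h3, h4⟩
        rw [h2, ENat.toNat_natCast]
        exact ⟨by exact_mod_cast h1, h3, fun i hi hj => h4 i ⟨by exact_mod_cast hj, hi⟩⟩
    rw [this]
    refine Finset.measurableSet_biUnion _ fun j _ => (ih j).inter (MeasurableSet.inter ?_ ?_)
    · exact ((hZ t).sub (hZ j)) hB
    · exact Finset.measurableSet_biInter _ fun i _ => (((hZ i).sub (hZ j)) hB).compl

lemma measurableSet_sampleTime_le (hB : MeasurableSet B) (hZ : ∀ t, Measurable fun a => Z a t)
    (n t : ℕ) : MeasurableSet {a | sampleTime B (Z a) n ≤ t} := by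
  have : {a | sampleTime B (Z a) n ≤ t} =
      ⋃ j ∈ Finset.range (t + 1), {a | sampleTime B (Z a) n = j} := by
    ext a
    simp only [Set.mem_ofPred_eq, Set.mem_iUnion, Finset.mem_range]
    constructor
    · intro h
      obtain ⟨j, hj⟩ := ENat.ne_top_iff_exists.1 (ne_top_of_le_ne_top (ENat.natCast_ne_top t) h)
      rw [← hj] at h
      have : j ≤ t := by exact_mod_cast h
      exact ⟨j, by omega, hj.symm⟩
    · rintro ⟨j, hj, h⟩
      rw [h]
      have : j ≤ t := by omega
      exact_mod_cast this
  rw [this]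
  exact Finset.measurableSet_biUnion _ fun j _ => measurableSet_sampleTime_eq hB hZ n j

lemma measurable_toNat_sampleTime (hB : MeasurableSet B) (hZ : ∀ t, Measurable fun a => Z a t)
    (n : ℕ) : Measurable fun a => (sampleTime B (Z a) n).toNat := by
  have : (fun a => (sampleTime B (Z a) n).toNat) =
      fun a => sInf {t : ℕ | sampleTime B (Z a) n ≤ t} := by
    ext a
    by_cases h : sampleTime B (Z a) n = ⊤
    -- If the sample never occurs, both sides take the default value `0`.
    · simp [h]
    · obtain ⟨j, hj⟩ := ENat.ne_top_iff_exists.1 h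
      rw [← hj, ENat.toNat_natCast]
      have : {t : ℕ | (j : ℕ∞) ≤ t} = Set.Ici j := by ext; simp
      rw [this, csInf_Ici]
  rw [this]
  exact measurable_nat_sInf fun t => measurableSet_sampleTime_le hB hZ n t

lemma measurable_sampleIncr (hB : MeasurableSet B) (hZ : ∀ t, Measurable fun a => Z a t)
    (n : ℕ) : Measurable fun a => sampleIncr B (Z a) n :=
  (measurable_apply_nat (F := fun t a => Z a t) hZ (measurable_toNat_sampleTime hB hZ n)).sub
    (measurable_apply_nat (F := fun t a => Z a t) hZ (measurable_toNat_sampleTime hB hZ (n - 1)))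

lemma measurable_numMessages (hB : MeasurableSet B) (hZ : ∀ t, Measurable fun a => Z a t)
    (t : ℕ) : Measurable fun a => numMessages B (Z a) t := by
  refine measurable_of_Ici fun n => ?_
  have : (fun a => numMessages B (Z a) t) ⁻¹' Set.Ici n = {a | sampleTime B (Z a) n ≤ t} := by
    ext a
    exact le_numMessages_iff
  rw [this]
  exact measurableSet_sampleTime_le hB hZ n t

lemma measurable_midRiser (L : ℝ) (b : ℕ) : Measurable (midRiser L b) := by
  unfold midRiser
  have : Measurable fun n : ℕ => ((min n (2 ^ b - 1) : ℕ) : ℝ) := measurable_of_countable _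
  exact ((this.comp (Nat.measurable_floor.comp (measurable_id.div_const _))).add_const _).const_mul _

lemma measurable_real_sign : Measurable Real.sign := by
  unfold Real.sign
  exact Measurable.ite measurableSet_Iio measurable_const
    (Measurable.ite measurableSet_Ioi measurable_const measurable_const)

lemma measurableSet_trigV (d : ℝ) : MeasurableSet (trigV d) := measurableSet_Ioo.compl

lemma measurableSet_trigU (e : ℝ) : MeasurableSet (trigU e) := measurableSet_Ici

lemma measurable_overV (d : ℝ) (hZ : ∀ t, Measurable fun a => Z a t) (n : ℕ) :
    Measurable fun a => overV d (Z a) n :=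
  (measurable_norm.comp (measurable_sampleIncr (measurableSet_trigV d) hZ n)).sub_const d

lemma measurable_overU (e : ℝ) (hZ : ∀ t, Measurable fun a => Z a t) (n : ℕ) :
    Measurable fun a => overU e (Z a) n :=
  (measurable_sampleIncr (measurableSet_trigU e) hZ n).sub_const e

lemma measurable_abs_quantErrorV_term (d φ : ℝ) (r : ℕ) (hZ : ∀ t, Measurable fun a => Z a t)
    (n : ℕ) : Measurable fun a => |midRiser φ r (overV d (Z a) n) - overV d (Z a) n| :=
  measurable_norm.comp
    (((measurable_midRiser φ r).comp (measurable_overV d hZ n)).sub (measurable_overV d hZ n))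

lemma measurable_abs_quantErrorU_term (e θ : ℝ) (r : ℕ) (hZ : ∀ t, Measurable fun a => Z a t)
    (n : ℕ) : Measurable fun a => |midRiser θ r (overU e (Z a) n) - overU e (Z a) n| :=
  measurable_norm.comp
    (((measurable_midRiser θ r).comp (measurable_overU e hZ n)).sub (measurable_overU e hZ n))

lemma measurable_approxV (d φ : ℝ) (r : ℕ) (hZ : ∀ t, Measurable fun a => Z a t) (t : ℕ) :
    Measurable fun a => approxV d φ r (Z a) t := by
  refine measurable_apply_nat (F := fun m a => ∑ n ∈ Finset.Icc 1 m,
    Real.sign (sampleIncr (trigV d) (Z a) n) * (d + midRiser φ (r - 1) (overV d (Z a) n)))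
    (fun m => Finset.measurable_fun_sum _ fun n _ => ?_)
    (measurable_numMessages (measurableSet_trigV d) hZ t)
  exact (measurable_real_sign.comp (measurable_sampleIncr (measurableSet_trigV d) hZ n)).mul
    (((measurable_midRiser φ (r - 1)).comp (measurable_overV d hZ n)).const_add d)

lemma measurable_approxU (e θ : ℝ) (r : ℕ) (hZ : ∀ t, Measurable fun a => Z a t) (t : ℕ) :
    Measurable fun a => approxU e θ r (Z a) t := by
  refine measurable_apply_nat (F := fun m a => ∑ n ∈ Finset.Icc 1 m,
    (e + midRiser θ r (overU e (Z a) n)))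
    (fun m => Finset.measurable_fun_sum _ fun n _ => ?_)
    (measurable_numMessages (measurableSet_trigU e) hZ t)
  exact ((measurable_midRiser θ r).comp (measurable_overU e hZ n)).const_add e

variable {K : ℕ} {h y w : α → Fin K → ℕ → ℂ}

lemma measurable_info (v : ℝ) {g : α → ℕ → ℂ} (hg : ∀ i, Measurable fun a => g a i) (t : ℕ) :
    Measurable fun a => info v (g a) t :=
  Finset.measurable_fun_sum _ fun i _ =>
    (((hg i).norm.pow_const 2).const_mul 2).div_const v

lemma measurable_corr (v : ℝ) {g z : α → ℕ → ℂ} (hg : ∀ i, Measurable fun a => g a i)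
    (hz : ∀ i, Measurable fun a => z a i) (t : ℕ) :
    Measurable fun a => corr v (g a) (z a) t :=
  Finset.measurable_fun_sum _ fun i _ =>
    ((Complex.measurable_re.comp (((Complex.continuous_conj.measurable).comp (hg i)).mul (hz i))).const_mul
      2).div_const v

lemma measurable_fusionU (D : Design K) (σ : Fin K → ℝ) (hh : ∀ k i, Measurable fun a => h a k i)
    (t : ℕ) : Measurable fun a => fusionU D σ (h a) t :=
  Finset.measurable_fun_sum _ fun k _ =>
    measurable_approxU _ _ _ (fun t => measurable_info _ (hh k) t) t

lemma measurable_fusionV (D : Design K) (σ : Fin K → ℝ) (hh : ∀ k i, Measurable fun a => h a k i)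
    (hy : ∀ k i, Measurable fun a => y a k i) (t : ℕ) :
    Measurable fun a => fusionV D σ (h a) (y a) t :=
  Finset.measurable_fun_sum _ fun k _ =>
    measurable_approxV _ _ _ (fun t => measurable_corr _ (hh k) (hy k) t) t

lemma measurable_fisherInfo (σ : Fin K → ℝ) (hh : ∀ k i, Measurable fun a => h a k i)
    (t : ℕ) : Measurable fun a => fisherInfo σ (h a) t :=
  Finset.measurable_fun_sum _ fun k _ => measurable_info _ (hh k) t

lemma measurable_stopTime (D : Design K) (σ : Fin K → ℝ) (T : ℝ)
    (hh : ∀ k i, Measurable fun a => h a k i) : Measurable fun a => stopTime D σ T (h a) :=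
  measurable_nat_sInf fun t => measurableSet_le measurable_const (measurable_fusionU D σ hh t)

lemma measurable_observe (x : ℂ) (hh : ∀ k i, Measurable fun a => h a k i)
    (hw : ∀ k i, Measurable fun a => w a k i) (k : Fin K) (i : ℕ) :
    Measurable fun a => observe x (h a) (w a) k i :=
  ((hh k i).const_mul x).add (hw k i)

lemma measurable_normalizedError (D : Design K) (σ : Fin K → ℝ) (T : ℝ) (x : ℂ)
    (hh : ∀ k i, Measurable fun a => h a k i) (hw : ∀ k i, Measurable fun a => w a k i) :
    Measurable fun a => normalizedError D σ T x (h a) (w a) := by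
  have hτ := measurable_stopTime D σ T hh
  have hy := measurable_observe x hh hw
  refine (Measurable.sqrt ?_).mul (((Measurable.div ?_ ?_)).sub_const _)
  · exact measurable_apply_nat (F := fun t a => fisherInfo σ (h a) t)
      (fun t => measurable_fisherInfo σ hh t) hτ
  · exact measurable_apply_nat (F := fun t a => fusionV D σ (h a) (observe x (h a) (w a)) t)
      (fun t => measurable_fusionV D σ hh hy t) hτ
  · exact measurable_apply_nat (F := fun t a => fusionU D σ (h a) t)
      (fun t => measurable_fusionU D σ hh t) hτ

end Measurability

/-- The stopped gains are a measurable function of the whole gain sequence, so independence from the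
latter passes to this σ-algebra. -/
lemma gainsUpToStop_le_comap {α : Type*} {K : ℕ} (D : Design K) (σ : Fin K → ℝ) (T : ℝ)
    (h : α → Fin K → ℕ → ℂ) :
    gainsUpToStop D σ T h ≤ MeasurableSpace.comap h inferInstance := by
  set F : (Fin K → ℕ → ℂ) → ℕ × (Fin K → ℕ → ℂ) := fun g =>
    (stopTime D σ T g, fun k i => if i < stopTime D σ T g then g k i else 0)
  have hg : ∀ (k : Fin K) (i : ℕ), Measurable fun g : Fin K → ℕ → ℂ => g k i :=
    fun k i => (measurable_pi_apply i).comp (measurable_pi_apply k)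
  have hF : Measurable F := by
    have hτ := measurable_stopTime D σ T hg
    refine hτ.prodMk (measurable_pi_lambda _ fun k => measurable_pi_lambda _ fun i => ?_)
    exact Measurable.ite (hτ measurableSet_Ioi) (hg k i) measurable_const
  have : gainsUpToStop D σ T h = MeasurableSpace.comap h (MeasurableSpace.comap F inferInstance) := by
    rw [MeasurableSpace.comap_comp]
    rfl
  rw [this]
  exact MeasurableSpace.comap_mono hF.comap_le

/-! ### Gaussian linear forms and product laws -/

section Gaussian

instance (v : ℝ) : IsProbabilityMeasure (complexGaussian v) := by
  unfold complexGaussian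
  exact Measure.isProbabilityMeasure_map (Measurable.aemeasurable (by
    exact Complex.measurableEquivRealProd.symm.measurable))

lemma map_re_im_complexGaussian {v : ℝ} (a b : ℝ) :
    (complexGaussian v).map (fun z : ℂ => a * z.re + b * z.im) =
      gaussianReal 0 ((a ^ 2 + b ^ 2) * (v / 2)).toNNReal := by
  have hm : Measurable fun p : ℝ × ℝ => (⟨p.1, p.2⟩ : ℂ) :=
    Complex.measurableEquivRealProd.symm.measurable
  have hl : Measurable fun z : ℂ => a * z.re + b * z.im :=
    (Complex.measurable_re.const_mul a).add (Complex.measurable_im.const_mul b)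
  rw [complexGaussian, Measure.map_map hl hm]
  set γ := gaussianReal 0 (v / 2).toNNReal
  have hX : (γ.prod γ).map (fun p : ℝ × ℝ => a * p.1) =
      gaussianReal (a * 0) (NNReal.mk (a ^ 2) (sq_nonneg a) * (v / 2).toNNReal) := by
    have hma : Measurable fun x : ℝ => a * x := measurable_id.const_mul a
    have hfst : (γ.prod γ).map Prod.fst = γ := measurePreserving_fst.map_eq
    rw [← gaussianReal_map_const_mul a]
    change _ = γ.map _
    conv_rhs => rw [← hfst]
    rw [Measure.map_map hma measurable_fst]
    rfl
  have hY : (γ.prod γ).map (fun p : ℝ × ℝ => b * p.2) =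
      gaussianReal (b * 0) (NNReal.mk (b ^ 2) (sq_nonneg b) * (v / 2).toNNReal) := by
    have hmb : Measurable fun x : ℝ => b * x := measurable_id.const_mul b
    have hsnd : (γ.prod γ).map Prod.snd = γ := measurePreserving_snd.map_eq
    rw [← gaussianReal_map_const_mul b]
    change _ = γ.map _
    conv_rhs => rw [← hsnd]
    rw [Measure.map_map hmb measurable_snd]
    rfl
  have hind : IndepFun (fun p : ℝ × ℝ => a * p.1) (fun p : ℝ × ℝ => b * p.2) (γ.prod γ) :=
    indepFun_prod (X := fun x => a * x) (Y := fun x => b * x) (measurable_id.const_mul a)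
      (measurable_id.const_mul b)
  have := gaussianReal_add_gaussianReal_of_indepFun hind hX hY
  have hv : ((a ^ 2 + b ^ 2) * (v / 2)).toNNReal =
      NNReal.mk (a ^ 2) (sq_nonneg a) * (v / 2).toNNReal +
        NNReal.mk (b ^ 2) (sq_nonneg b) * (v / 2).toNNReal := by
    rw [← add_mul, Real.toNNReal_mul (by positivity)]
    congr 1
    exact Real.toNNReal_of_nonneg _
  rw [hv]
  rw [mul_zero, mul_zero, add_zero] at this
  exact this

/-- The variance is `(4 ‖g‖² / v²) (v / 2)`, which is exactly one increment of the Fisher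
information; this makes the normalization by `√U` exact. -/
lemma map_correlation_complexGaussian {v : ℝ} (hv : 0 < v) (g : ℂ) :
    (complexGaussian v).map (fun z : ℂ => 2 * (starRingEnd ℂ g * z).re / v) =
      gaussianReal 0 (2 * ‖g‖ ^ 2 / v).toNNReal := by
  have := map_re_im_complexGaussian (v := v) (2 * g.re / v) (2 * g.im / v)
  have h1 : (fun z : ℂ => 2 * (starRingEnd ℂ g * z).re / v) =
      fun z : ℂ => 2 * g.re / v * z.re + 2 * g.im / v * z.im := by
    ext z
    simp only [Complex.mul_re, Complex.conj_re, Complex.conj_im]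
    ring
  rw [h1, this]
  congr 2
  rw [Complex.sq_norm, Complex.normSq_apply]
  field_simp

lemma map_sum_gaussianReal {Ω ι : Type*} [MeasurableSpace Ω] {μ : Measure Ω}
    [IsProbabilityMeasure μ] {X : ι → Ω → ℝ} (hX : ∀ p, Measurable (X p)) (hind : iIndepFun X μ)
    {v : ι → ℝ} (hv : ∀ p, 0 ≤ v p) (hlaw : ∀ p, μ.map (X p) = gaussianReal 0 (v p).toNNReal)
    (s : Finset ι) :
    μ.map (fun ω => ∑ p ∈ s, X p ω) = gaussianReal 0 (∑ p ∈ s, v p).toNNReal := by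
  have : IsProbabilityMeasure (μ.map (fun ω => ∑ p ∈ s, X p ω)) :=
    Measure.isProbabilityMeasure_map (Finset.measurable_fun_sum _ fun p _ => hX p).aemeasurable
  refine Measure.ext_of_charFun ?_
  rw [iIndepFun.charFun_map_fun_finsetSum_eq_prod (fun p _ => (hX p).aemeasurable)
    (hind.precomp (g := ((↑) : s → ι)) Subtype.val_injective)]
  ext t
  simp only [Finset.prod_apply, hlaw, charFun_gaussianReal]
  rw [← Complex.exp_sum, Real.coe_toNNReal _ (Finset.sum_nonneg fun p _ => hv p)]
  congr 1
  simp only [Complex.ofReal_zero, mul_zero, zero_mul, zero_sub, Complex.ofReal_sum,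
    Finset.sum_neg_distrib, Finset.sum_mul, Finset.sum_div]
  refine congrArg _ (Finset.sum_congr rfl fun p _ => ?_)
  rw [Real.coe_toNNReal _ (hv p)]

/-- By Fubini: if the law of `g (a, ·)` is the same for almost every `a`, then `g` is independent of
the first coordinate. -/
lemma map_prodMk_eq_prod {α β : Type*} [MeasurableSpace α] [MeasurableSpace β] {P : Measure α}
    {Q : Measure β} [IsProbabilityMeasure P] [IsProbabilityMeasure Q] {γ : Measure ℝ}
    [IsProbabilityMeasure γ] {g : α × β → ℝ} (hg : Measurable g)
    (h : ∀ᵐ a ∂P, Q.map (fun b => g (a, b)) = γ) :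
    (P.prod Q).map (fun p => (p.1, g p)) = P.prod γ := by
  have hm : Measurable fun p : α × β => (p.1, g p) := measurable_fst.prodMk hg
  ext s hs
  rw [Measure.map_apply hm hs, Measure.prod_apply (hm hs), Measure.prod_apply hs]
  refine lintegral_congr_ae (h.mono fun a ha => ?_)
  simp only
  have hga : Measurable fun b => g (a, b) := hg.comp measurable_prodMk_left
  rw [← ha, Measure.map_apply hga (measurable_prodMk_left hs)]
  rfl

end Gaussian

/-! ### The normalized score: exactly Gaussian, independent of the gains -/

section Score

variable {K : ℕ}

/-- The noise part `∑_k ∑_{i < t} 2 Re (conj (h_i) w_i) / σ_k²` of the sum of the correlations. -/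
noncomputable def score (σ : Fin K → ℝ) (h w : Fin K → ℕ → ℂ) (t : ℕ) : ℝ :=
  ∑ k, corr (σ k ^ 2) (h k) (w k) t

/-- The score at the stopping time, divided by the root of the conditional Fisher information. -/
noncomputable def normalizedScore (D : Design K) (σ : Fin K → ℝ) (T : ℝ)
    (h w : Fin K → ℕ → ℂ) : ℝ :=
  score σ h w (stopTime D σ T h) / √(fisherInfo σ h (stopTime D σ T h))

lemma corr_observe (x : ℂ) (v : ℝ) (h w : Fin K → ℕ → ℂ) (k : Fin K) (t : ℕ) :
    corr v (h k) (observe x h w k) t = x.re * info v (h k) t + corr v (h k) (w k) t := by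
  rw [corr, corr, info, Finset.mul_sum, ← Finset.sum_add_distrib]
  refine Finset.sum_congr rfl fun i _ => ?_
  rw [observe, Complex.sq_norm, Complex.normSq_apply]
  simp only [Complex.mul_re, Complex.add_re, Complex.add_im, Complex.mul_im, Complex.conj_re,
    Complex.conj_im]
  ring

variable {Ω : Type*} [MeasurableSpace Ω] {μ : Measure Ω} [IsProbabilityMeasure μ]
  {σ : Fin K → ℝ} {h w : Ω → Fin K → ℕ → ℂ}

lemma map_score (hσ : ∀ k, 0 < σ k) (hw_meas : ∀ k i, Measurable (fun ω => w ω k i))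
    (hw_law : ∀ k i, μ.map (fun ω => w ω k i) = complexGaussian (σ k ^ 2))
    (hw_indep : iIndepFun (fun (p : Fin K × ℕ) ω => w ω p.1 p.2) μ)
    (g : Fin K → ℕ → ℂ) (t : ℕ) :
    μ.map (fun ω => score σ g (w ω) t) = gaussianReal 0 (fisherInfo σ g t).toNNReal := by
  have hf : ∀ p : Fin K × ℕ,
      Measurable fun z : ℂ => 2 * (starRingEnd ℂ (g p.1 p.2) * z).re / σ p.1 ^ 2 := fun p =>
    ((Complex.measurable_re.comp (measurable_id.const_mul _)).const_mul 2).div_const _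
  have h1 := map_sum_gaussianReal (μ := μ)
    (X := fun (p : Fin K × ℕ) ω => 2 * (starRingEnd ℂ (g p.1 p.2) * w ω p.1 p.2).re / σ p.1 ^ 2)
    (v := fun p => 2 * ‖g p.1 p.2‖ ^ 2 / σ p.1 ^ 2)
    (fun p => (hf p).comp (hw_meas p.1 p.2))
    (hw_indep.comp (fun p z => 2 * (starRingEnd ℂ (g p.1 p.2) * z).re / σ p.1 ^ 2) hf)
    (fun p => by positivity)
    (fun p => by
      rw [← map_correlation_complexGaussian (pow_pos (hσ p.1) 2), ← hw_law p.1 p.2,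
        Measure.map_map (hf p) (hw_meas p.1 p.2)]
      rfl)
    (Finset.univ ×ˢ Finset.range t)
  simp only [Finset.sum_product] at h1
  exact h1

/-- For frozen gains the stopping time is a constant, so the score there is a sum of a fixed number
of Gaussians. -/
lemma map_normalizedScore (hσ : ∀ k, 0 < σ k) (hw_meas : ∀ k i, Measurable (fun ω => w ω k i))
    (hw_law : ∀ k i, μ.map (fun ω => w ω k i) = complexGaussian (σ k ^ 2))
    (hw_indep : iIndepFun (fun (p : Fin K × ℕ) ω => w ω p.1 p.2) μ)
    (D : Design K) (T : ℝ) {g : Fin K → ℕ → ℂ}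
    (hg : 0 < fisherInfo σ g (stopTime D σ T g)) :
    μ.map (fun ω => normalizedScore D σ T g (w ω)) = gaussianReal 0 1 := by
  set t := stopTime D σ T g with ht
  have hm : Measurable fun ω => score σ g (w ω) t :=
    Finset.measurable_fun_sum _ fun k _ =>
      measurable_corr (g := fun _ => g k) _ (fun _ => measurable_const) (hw_meas k) t
  have h1 := map_score hσ hw_meas hw_law hw_indep g t
  have h2 : (fun ω => normalizedScore D σ T g (w ω)) =
      (fun z => z / √(fisherInfo σ g t)) ∘ fun ω => score σ g (w ω) t := rfl
  have hd : Measurable fun z : ℝ => z / √(fisherInfo σ g t) := measurable_id.div_const _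
  rw [h2, ← Measure.map_map hd hm, h1, gaussianReal_map_div_const]
  congr 1
  · simp
  · apply NNReal.eq
    simp [hg.le, Real.sq_sqrt, hg.ne']

lemma measurable_normalizedScore {α : Type*} [MeasurableSpace α] {h w : α → Fin K → ℕ → ℂ}
    (D : Design K) (σ : Fin K → ℝ) (T : ℝ)
    (hh : ∀ k i, Measurable fun a => h a k i) (hw : ∀ k i, Measurable fun a => w a k i) :
    Measurable fun a => normalizedScore D σ T (h a) (w a) := by
  have hτ := measurable_stopTime D σ T hh
  refine Measurable.div ?_ (Measurable.sqrt ?_)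
  · exact measurable_apply_nat (F := fun t a => score σ (h a) (w a) t)
      (fun t => Finset.measurable_fun_sum _ fun k _ => measurable_corr _ (hh k) (hw k) t) hτ
  · exact measurable_apply_nat (F := fun t a => fisherInfo σ (h a) t)
      (fun t => measurable_fisherInfo σ hh t) hτ

lemma map_gains_normalizedScore (hσ : ∀ k, 0 < σ k)
    (hh_meas : ∀ k i, Measurable (fun ω => h ω k i))
    (hw_meas : ∀ k i, Measurable (fun ω => w ω k i))
    (hw_law : ∀ k i, μ.map (fun ω => w ω k i) = complexGaussian (σ k ^ 2))
    (hw_indep : iIndepFun (fun (p : Fin K × ℕ) ω => w ω p.1 p.2) μ)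
    (hhw_indep : IndepFun h w μ) (D : Design K) (T : ℝ)
    (hpos : ∀ᵐ ω ∂μ, 0 < fisherInfo σ (h ω) (stopTime D σ T (h ω))) :
    μ.map (fun ω => (h ω, normalizedScore D σ T (h ω) (w ω))) =
      (μ.map h).prod (gaussianReal 0 1) := by
  have hh : Measurable h := measurable_pi_lambda _ fun k => measurable_pi_lambda _ (hh_meas k)
  have hw : Measurable w := measurable_pi_lambda _ fun k => measurable_pi_lambda _ (hw_meas k)
  have hev : ∀ (k : Fin K) (i : ℕ), Measurable fun g : Fin K → ℕ → ℂ => g k i :=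
    fun k i => (measurable_pi_apply i).comp (measurable_pi_apply k)
  have : IsProbabilityMeasure (μ.map h) := Measure.isProbabilityMeasure_map hh.aemeasurable
  have : IsProbabilityMeasure (μ.map w) := Measure.isProbabilityMeasure_map hw.aemeasurable
  set G : (Fin K → ℕ → ℂ) × (Fin K → ℕ → ℂ) → ℝ := fun p => normalizedScore D σ T p.1 p.2
  have hG : Measurable G := measurable_normalizedScore D σ T
    (fun k i => (hev k i).comp measurable_fst) (fun k i => (hev k i).comp measurable_snd)
  have key := map_prodMk_eq_prod (P := μ.map h) (Q := μ.map w) (γ := gaussianReal 0 1) hG (by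
    have hS : MeasurableSet {g : Fin K → ℕ → ℂ | 0 < fisherInfo σ g (stopTime D σ T g)} :=
      measurableSet_lt measurable_const (measurable_apply_nat
        (F := fun t (g : Fin K → ℕ → ℂ) => fisherInfo σ g t)
        (fun t => measurable_fisherInfo σ hev t) (measurable_stopTime D σ T hev))
    refine ((ae_map_iff hh.aemeasurable hS).2 hpos).mono fun g hg => ?_
    have hGg : Measurable fun b => G (g, b) := hG.comp measurable_prodMk_left
    rw [Measure.map_map hGg hw]
    exact map_normalizedScore hσ hw_meas hw_law hw_indep D T hg)
  rw [← key, ← (indepFun_iff_map_prod_eq_prod_map_map hh.aemeasurable hw.aemeasurable).1 hhw_indep,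
    Measure.map_map (measurable_fst.prodMk hG) (hh.prodMk hw)]
  rfl

end Score

/-! ### Deterministic comparison of error and score -/

/-- With `G = M / √U` and `a = (V' - V) - R (U' - U)`, the difference equals `(G (U - U') + √U a) /
U'`. The first term contributes `b / √T`, by `|G| ≤ √T` and `T ≤ U'`. The second contributes `2 (1 +
|R|) b / √T`: the bound `b ≤ T` gives `U ≤ 2 U'`, hence `√U √T ≤ 2 U'`. -/
lemma abs_sqrt_mul_div_sub_sub_div_sqrt_le {R U V U' V' M T b : ℝ} (hT : 0 < T) (hU : 0 < U)
    (hb : 0 ≤ b) (hbT : b ≤ T) (hV : V = R * U + M) (hU' : |U' - U| ≤ b) (hV' : |V' - V| ≤ b)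
    (hTU : T ≤ U') (hM : |M / √U| ≤ √T) :
    |√U * (V' / U' - R) - M / √U| ≤ (3 + 2 * |R|) * (b / √T) := by
  have hs : 0 < √U := Real.sqrt_pos.2 hU
  have hr : 0 < √T := Real.sqrt_pos.2 hT
  have hU'pos : 0 < U' := hT.trans_le hTU
  have hss : √U * √U = U := Real.mul_self_sqrt hU.le
  have hrr : √T * √T = T := Real.mul_self_sqrt hT.le
  set s := √U
  set r := √T
  set G := M / s with hG
  have hGs : M = G * s := by rw [hG]; field_simp
  set a := (V' - V) - R * (U' - U) with ha
  have habs : |a| ≤ (1 + |R|) * b := by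
    calc |a| ≤ |V' - V| + |R * (U' - U)| := abs_sub _ _
      _ ≤ b + |R| * b := by rw [abs_mul]; gcongr
      _ = _ := by ring
  have heq : s * (V' / U' - R) - G = (G * (U - U') + s * a) / U' := by
    rw [ha, hV, hGs, ← hss]
    field_simp
    ring
  have hsr : s * r ≤ 2 * U' := by
    have : U ≤ 2 * U' := by linarith [(abs_le.1 hU').1]
    refine abs_le_of_sq_le_sq' ?_ (by linarith) |>.2
    calc (s * r) ^ 2 = (s * s) * (r * r) := by ring
      _ = U * T := by rw [hss, hrr]
      _ ≤ (2 * U') * U' := by gcongr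
      _ ≤ (2 * U') ^ 2 := by nlinarith
  rw [heq, abs_div, abs_of_pos hU'pos, div_le_iff₀ hU'pos]
  have h1 : |G * (U - U') + s * a| ≤ r * b + s * ((1 + |R|) * b) := by
    refine (abs_add_le _ _).trans (add_le_add ?_ ?_)
    · rw [abs_mul, abs_sub_comm]; gcongr
    · rw [abs_mul, abs_of_pos hs]; gcongr
  refine h1.trans ?_
  rw [mul_div_assoc', div_mul_eq_mul_div, le_div_iff₀ hr]
  have h2 : r * r * b ≤ U' * b := by rw [hrr]; gcongr
  have h3 : s * r * ((1 + |R|) * b) ≤ 2 * U' * ((1 + |R|) * b) := by gcongr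
  linarith

/-! ### Message counts and errors at the stopping time -/

section Stopping

variable {K : ℕ} {D : Design K} {σ : Fin K → ℝ} {T : ℝ} {h w : Fin K → ℕ → ℂ}

lemma info_zero (v : ℝ) (g : ℕ → ℂ) : info v g 0 = 0 := by simp [info]

lemma corr_zero (v : ℝ) (g y : ℕ → ℂ) : corr v g y 0 = 0 := by simp [corr]

lemma info_mono {v : ℝ} (hv : 0 ≤ v) (g : ℕ → ℂ) : Monotone (info v g) := fun _ _ hst =>
  Finset.sum_le_sum_of_subset_of_nonneg (Finset.range_subset_range.2 hst)
    fun _ _ _ => by positivity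

lemma fusionU_zero (D : Design K) (σ : Fin K → ℝ) (h : Fin K → ℕ → ℂ) : fusionU D σ h 0 = 0 := by
  refine Finset.sum_eq_zero fun k _ => ?_
  have : numMessages (trigU (D.e k)) (info (σ k ^ 2) (h k)) 0 = 0 := Nat.le_zero.1 (numMessages_le 0)
  rw [approxU, this]
  simp

lemma le_fusionU_stopTime (hreach : ∃ t, T ≤ fusionU D σ h t) :
    T ≤ fusionU D σ h (stopTime D σ T h) :=
  Nat.sInf_mem (s := {t | T ≤ fusionU D σ h t}) hreach

lemma fusionU_lt_of_lt_stopTime {t : ℕ} (ht : t < stopTime D σ T h) : fusionU D σ h t < T := by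
  by_contra! hle
  exact absurd (Nat.sInf_le (show t ∈ {t | T ≤ fusionU D σ h t} from hle)) (not_le.2 ht)

lemma stopTime_pos (hT : 0 < T) (hreach : ∃ t, T ≤ fusionU D σ h t) : 0 < stopTime D σ T h := by
  rw [Nat.pos_iff_ne_zero]
  intro h0
  have := le_fusionU_stopTime hreach
  rw [h0, fusionU_zero] at this
  linarith

lemma fisherInfo_pos (hσ : ∀ k, 0 < σ k) (k : Fin K) (hk : h k 0 ≠ 0) {t : ℕ} (ht : 0 < t) :
    0 < fisherInfo σ h t := by
  have h1 : 0 < info (σ k ^ 2) (h k) 1 := by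
    have := hσ k
    have := norm_pos_iff.2 hk
    simp only [info, Finset.sum_range_one]
    positivity
  have h2 : info (σ k ^ 2) (h k) 1 ≤ info (σ k ^ 2) (h k) t := info_mono (sq_nonneg _) _ ht
  have h3 : info (σ k ^ 2) (h k) t ≤ fisherInfo σ h t :=
    Finset.single_le_sum (f := fun k => info (σ k ^ 2) (h k) t)
      (fun k _ => by unfold info; positivity) (Finset.mem_univ k)
  linarith

lemma mul_numMessages_le_fusionU (he : ∀ k, 0 < D.e k) (hθ : ∀ k, 0 ≤ D.θ k) (k : Fin K) (t : ℕ) :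
    D.e k * numMessages (trigU (D.e k)) (info (σ k ^ 2) (h k)) t ≤ fusionU D σ h t := by
  have h1 : ∀ k, D.e k * numMessages (trigU (D.e k)) (info (σ k ^ 2) (h k)) t ≤
      approxU (D.e k) (D.θ k) D.rU (info (σ k ^ 2) (h k)) t := fun k =>
    mul_numMessages_le_approxU (hθ k) _ _ _
  refine (h1 k).trans (Finset.single_le_sum
    (f := fun k => approxU (D.e k) (D.θ k) D.rU (info (σ k ^ 2) (h k)) t)
    (fun k _ => le_trans ?_ (h1 k)) (Finset.mem_univ k))
  have := he k
  positivity

/-- One step before `t` the approximation of `U` is still below `T`, although every message has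
added at least `e`. The last step brings at most one more message. -/
lemma numMessages_le_of_le_stopTime (he : ∀ k, 0 < D.e k) (hθ : ∀ k, 0 ≤ D.θ k) (hT : 0 ≤ T)
    (k : Fin K) {t : ℕ} (ht : t ≤ stopTime D σ T h) :
    (numMessages (trigU (D.e k)) (info (σ k ^ 2) (h k)) t : ℝ) ≤ T / D.e k + 1 := by
  have hek := he k
  rcases Nat.eq_zero_or_pos t with rfl | hpos
  · have : numMessages (trigU (D.e k)) (info (σ k ^ 2) (h k)) 0 = 0 :=
      Nat.le_zero.1 (numMessages_le 0)
    rw [this]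
    simp only [CharP.cast_eq_zero]
    positivity
  · obtain ⟨s, rfl⟩ := Nat.exists_eq_add_of_le' hpos
    have h1 : numMessages (trigU (D.e k)) (info (σ k ^ 2) (h k)) (s + 1) ≤
      numMessages (trigU (D.e k)) (info (σ k ^ 2) (h k)) s + 1 := numMessages_succ_le s
    have h2 := (mul_numMessages_le_fusionU (σ := σ) (h := h) he hθ k s).trans
      (fusionU_lt_of_lt_stopTime ht).le
    rw [mul_comm, ← le_div_iff₀ hek] at h2
    have h1' : (numMessages (trigU (D.e k)) (info (σ k ^ 2) (h k)) (s + 1) : ℝ) ≤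
      numMessages (trigU (D.e k)) (info (σ k ^ 2) (h k)) s + 1 := by exact_mod_cast h1
    linarith

lemma abs_fusionU_sub_le (he : ∀ k, 0 < D.e k) (hθ : ∀ k, 0 ≤ D.θ k) (hT : 0 ≤ T)
    {m : Fin K → ℕ} (hm : ∀ k, T / D.e k + 1 ≤ m k) {t : ℕ} (ht : t ≤ stopTime D σ T h) :
    |fusionU D σ h t - fisherInfo σ h t| ≤
      ∑ k, (D.e k + quantErrorU (D.e k) (D.θ k) D.rU (info (σ k ^ 2) (h k)) (m k)) := by
  rw [fusionU, fisherInfo, ← Finset.sum_sub_distrib]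
  refine (Finset.abs_sum_le_sum_abs _ _).trans (Finset.sum_le_sum fun k _ => ?_)
  refine (abs_approxU_sub_le (he k) _ _ (info_zero _ _) (info_mono (sq_nonneg _) _) t).trans ?_
  gcongr
  refine quantErrorU_mono _ _ _ _ ?_
  exact_mod_cast (numMessages_le_of_le_stopTime he hθ hT k ht).trans (hm k)

/-- A bound on the total variation of `V` up to time `N`, in terms of the gains and the noise. -/
noncomputable def variationBound (c v : ℝ) (g z : ℕ → ℂ) (N : ℕ) : ℝ :=
  ∑ i ∈ Finset.range N, ((c + 1) * (2 * ‖g i‖ ^ 2 / v) + ‖z i‖ ^ 2 / v)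

lemma variation_corr_observe_le (x : ℂ) {v : ℝ} (hv : 0 ≤ v) (k : Fin K) {t N : ℕ} (ht : t ≤ N) :
    ∑ i ∈ Finset.range t, |corr v (h k) (observe x h w k) (i + 1) - corr v (h k) (observe x h w k) i|
      ≤ variationBound |x.re| v (h k) (w k) N := by
  refine le_trans (Finset.sum_le_sum fun i _ => ?_)
    (Finset.sum_le_sum_of_subset_of_nonneg (Finset.range_subset_range.2 ht)
      fun i _ _ => by positivity)
  rw [corr_observe, corr_observe, corr, corr, info, info, Finset.sum_range_succ,
    Finset.sum_range_succ]
  set a := 2 * ‖h k i‖ ^ 2 / v with ha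
  have ha0 : 0 ≤ a := by positivity
  set b := 2 * (starRingEnd ℂ (h k i) * w k i).re / v with hb
  -- By AM-GM the cross term is split into gain and noise energies, whose means are finite; the `a /
  -- 2` is absorbed by the `+ 1` in `variationBound`.
  have h1 : |b| ≤ a / 2 + ‖w k i‖ ^ 2 / v := by
    have h2 : |(starRingEnd ℂ (h k i) * w k i).re| ≤ ‖h k i‖ * ‖w k i‖ := by
      refine (Complex.abs_re_le_norm _).trans ?_
      rw [norm_mul, Complex.norm_conj]
    rw [hb, abs_div, abs_mul, abs_of_nonneg hv, ha, div_div, mul_comm v 2, ← div_div,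
      mul_div_cancel_left₀ _ (two_ne_zero), ← add_div]
    gcongr
    rw [abs_two]
    nlinarith [sq_nonneg (‖h k i‖ - ‖w k i‖)]
  calc _ = |x.re * a + b| := by congr 1; ring
    _ ≤ |x.re| * a + |b| := by
      refine (abs_add_le _ _).trans ?_
      rw [abs_mul, abs_of_nonneg ha0]
    _ ≤ _ := by linarith

lemma abs_fusionV_sub_le (x : ℂ) (hd : ∀ k, 0 < D.d k) {m : Fin K → ℕ} {N t : ℕ} (ht : t ≤ N)
    (hm : ∀ k, variationBound |x.re| (σ k ^ 2) (h k) (w k) N < D.d k * (m k + 1)) :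
    |fusionV D σ h (observe x h w) t - (x.re * fisherInfo σ h t + score σ h w t)| ≤
      ∑ k, (D.d k + quantErrorV (D.d k) (D.φ k) D.rV
        (corr (σ k ^ 2) (h k) (observe x h w k)) (m k)) := by
  have h1 : x.re * fisherInfo σ h t + score σ h w t =
      ∑ k, corr (σ k ^ 2) (h k) (observe x h w k) t := by
    simp only [corr_observe, fisherInfo, score, Finset.sum_add_distrib, Finset.mul_sum]
  rw [h1, fusionV, ← Finset.sum_sub_distrib]
  refine (Finset.abs_sum_le_sum_abs _ _).trans (Finset.sum_le_sum fun k _ => ?_)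
  refine (abs_approxV_sub_le (hd k) _ _ (corr_zero _ _ _) t).trans ?_
  gcongr
  refine quantErrorV_mono _ _ _ _ ?_
  have h2 : D.d k * numMessages (trigV (D.d k)) (corr (σ k ^ 2) (h k) (observe x h w k)) t ≤
      variationBound |x.re| (σ k ^ 2) (h k) (w k) N := by
    refine (mul_numMessages_le_variation (fun z hz => ?_) t).trans
      (variation_corr_observe_le x (sq_nonneg _) k ht)
    by_contra! hlt
    exact hz (abs_lt.1 hlt)
  have h3 := lt_of_mul_lt_mul_left (h2.trans_lt (hm k)) (hd k).le
  have : numMessages (trigV (D.d k)) (corr (σ k ^ 2) (h k) (observe x h w k)) t < m k + 1 := by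
    exact_mod_cast h3
  omega

/-- The order of the bounds avoids circularity. The error in `U` is controlled up to the stopping
time with no bound on that time; this control forces stopping by `N`; only then does the variation
up to `N` limit the number of `V` messages. -/
theorem abs_normalizedError_sub_normalizedScore_le (x : ℂ) {η : ℝ} (hη : 0 ≤ η) (hT : 0 < T)
    (hd : ∀ k, 0 < D.d k ∧ D.d k ≤ η * √T) (he : ∀ k, 0 < D.e k ∧ D.e k ≤ η * √T)
    (hθ : ∀ k, 0 ≤ D.θ k) {m n : Fin K → ℕ} {N : ℕ} (hm : ∀ k, T / D.e k + 1 ≤ m k)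
    (hηT : 2 * K * η * √T ≤ T)
    (hU : ∀ k, quantErrorU (D.e k) (D.θ k) D.rU (info (σ k ^ 2) (h k)) (m k) ≤ η * √T)
    (hV : ∀ k, quantErrorV (D.d k) (D.φ k) D.rV (corr (σ k ^ 2) (h k) (observe x h w k)) (n k) ≤
      η * √T)
    (hN : 2 * T ≤ fisherInfo σ h N)
    (hn : ∀ k, variationBound |x.re| (σ k ^ 2) (h k) (w k) N < D.d k * (n k + 1))
    (hreach : ∃ t, T ≤ fusionU D σ h t) (hpos : 0 < fisherInfo σ h (stopTime D σ T h))
    (hG : |normalizedScore D σ T h w| ≤ √T) :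
    |normalizedError D σ T x h w - normalizedScore D σ T h w| ≤ (3 + 2 * |x.re|) * (2 * K * η) := by
  have hsqrt : 0 < √T := Real.sqrt_pos.2 hT
  have hUbd : ∀ t ≤ stopTime D σ T h,
      |fusionU D σ h t - fisherInfo σ h t| ≤ 2 * K * η * √T := fun t ht => by
    refine (abs_fusionU_sub_le (fun k => (he k).1) hθ hT.le hm ht).trans ?_
    refine (Finset.sum_le_sum fun k _ => add_le_add (he k).2 (hU k)).trans (le_of_eq ?_)
    simp only [Finset.sum_const, Finset.card_univ, Fintype.card_fin, nsmul_eq_mul]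
    ring
  -- Otherwise the approximation at `N` would be below `T`, while it is within `T` of a quantity at
  -- least `2 * T`.
  have hτN : stopTime D σ T h ≤ N := by
    by_contra! hlt
    have h1 := fusionU_lt_of_lt_stopTime hlt
    have h2 := (abs_le.1 (hUbd N hlt.le)).1
    linarith
  have hVbd : |fusionV D σ h (observe x h w) (stopTime D σ T h) -
      (x.re * fisherInfo σ h (stopTime D σ T h) + score σ h w (stopTime D σ T h))| ≤
      2 * K * η * √T := by
    refine (abs_fusionV_sub_le x (fun k => (hd k).1) hτN hn).trans ?_
    refine (Finset.sum_le_sum fun k _ => add_le_add (hd k).2 (hV k)).trans (le_of_eq ?_)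
    simp only [Finset.sum_const, Finset.card_univ, Fintype.card_fin, nsmul_eq_mul]
    ring
  have := abs_sqrt_mul_div_sub_sub_div_sqrt_le hT hpos (by positivity) hηT rfl (hUbd _ le_rfl)
    hVbd (le_fusionU_stopTime hreach) hG
  rwa [mul_div_assoc, div_self hsqrt.ne', mul_one] at this

end Stopping

/-! ### Bit rates against the number of messages -/

section Rates

variable {d φ : ℝ → ℝ} {r : ℝ → ℕ}

lemma tendsto_sqrt_div_atTop (hd : ∀ᶠ T in atTop, 0 < d T) (hdo : d =o[atTop] fun T => √T) :
    Tendsto (fun T => √T / d T) atTop atTop := by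
  have h1 : Tendsto (fun T => d T / √T) atTop (𝓝[>] 0) := by
    refine tendsto_nhdsWithin_iff.2 ⟨hdo.tendsto_div_nhds_zero, ?_⟩
    filter_upwards [hd, eventually_gt_atTop 0] with T h1 h2
    exact div_pos h1 (Real.sqrt_pos.2 h2)
  refine (h1.inv_tendsto_nhdsGT_zero).congr fun T => ?_
  simp

lemma tendsto_sq_mul_range_div_pow (hd : ∀ᶠ T in atTop, 0 < d T) (hφ : ∀ᶠ T in atTop, 0 < φ T)
    (hdo : d =o[atTop] fun T => √T)
    (hgrowth : ∀ ε > 0, φ =O[atTop] fun T => (2 : ℝ) ^ (ε * (r T : ℝ)))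
    (hr : (fun T => Real.log (√T / d T)) =o[atTop] fun T => (r T : ℝ)) :
    Tendsto (fun T => (√T / d T) ^ 2 * (φ T / 2 ^ r T)) atTop (𝓝 0) := by
  have hρ := tendsto_sqrt_div_atTop hd hdo
  -- The budget is `2 ^ r = X ^ 8` with `X = 2 ^ (r / 8)`. The range costs at most `C X ^ 4`, and `ρ
  -- ≤ X` eventually, so the product is at most `C ρ² / X ^ 4 ≤ C / ρ²`.
  obtain ⟨C, hC⟩ := (hgrowth (1 / 2) (by norm_num)).bound
  have hlog2 : 0 < Real.log 2 := Real.log_pos (by norm_num)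
  have hlog := hr.bound (show 0 < Real.log 2 / 8 by positivity)
  have hlim : Tendsto (fun T => C * ((√T / d T) ^ 2)⁻¹) atTop (𝓝 0) := by
    rw [show (0 : ℝ) = C * 0 by simp]
    exact (((tendsto_pow_atTop two_ne_zero).comp hρ).inv_tendsto_atTop).const_mul C
  refine squeeze_zero' ?_ ?_ hlim
  · filter_upwards [hφ] with T h
    positivity
  filter_upwards [hφ, hC, hlog, hρ.eventually_ge_atTop 1] with T h1 h2 h3 h4
  set ρ := √T / d T
  have hρ0 : 0 < ρ := by linarith
  set X := (2 : ℝ) ^ ((r T : ℝ) / 8) with hX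
  have hXpos : 0 < X := by positivity
  have hX4 : (2 : ℝ) ^ (1 / 2 * (r T : ℝ)) = X ^ 4 := by
    rw [hX, ← Real.rpow_natCast, ← Real.rpow_mul (by norm_num)]
    congr 1
    push_cast
    ring
  have hX8 : (2 : ℝ) ^ r T = X ^ 8 := by
    rw [hX, ← Real.rpow_natCast (_ ^ _), ← Real.rpow_mul (by norm_num), ← Real.rpow_natCast]
    congr 1
    push_cast
    ring
  have hρX : ρ ≤ X := by
    rw [Real.norm_eq_abs, Real.norm_eq_abs, Nat.abs_cast] at h3
    rw [← Real.log_le_log_iff hρ0 hXpos, hX, Real.log_rpow (by norm_num)]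
    refine (le_abs_self _).trans (h3.trans (le_of_eq ?_))
    ring
  rw [Real.norm_eq_abs, Real.norm_eq_abs, abs_of_pos h1, hX4, abs_of_pos (by positivity)] at h2
  have hC0 : 0 ≤ C := by
    by_contra! hneg
    have : C * X ^ 4 ≤ 0 := mul_nonpos_of_nonpos_of_nonneg hneg.le (by positivity)
    linarith
  rw [hX8]
  calc ρ ^ 2 * (φ T / X ^ 8) ≤ ρ ^ 2 * (C * X ^ 4 / X ^ 8) := by gcongr
    _ = C * ρ ^ 2 / X ^ 4 := by field_simp
    _ ≤ C * ρ ^ 2 / ρ ^ 4 := by gcongr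
    _ = C * (ρ ^ 2)⁻¹ := by field_simp

end Rates

/-! ### Events of vanishing probability -/

section Probability

variable {Ω : Type*} [MeasurableSpace Ω] {μ : Measure Ω}

lemma tendsto_measure_le_of_lintegral_le {X : ℝ → Ω → ℝ} {b s : ℝ → ℝ}
    (hX : ∀ T, Measurable (X T)) (hs : ∀ᶠ T in atTop, 0 < s T)
    (hb : ∀ᶠ T in atTop, ∫⁻ ω, ENNReal.ofReal (X T ω) ∂μ ≤ ENNReal.ofReal (b T))
    (hlim : Tendsto (fun T => b T / s T) atTop (𝓝 0)) :
    Tendsto (fun T => μ {ω | s T ≤ X T ω}) atTop (𝓝 0) := by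
  have h0 : Tendsto (fun T => ENNReal.ofReal (b T / s T)) atTop (𝓝 0) := by
    simpa using ENNReal.tendsto_ofReal hlim
  refine tendsto_of_tendsto_of_tendsto_of_le_of_le' tendsto_const_nhds h0
    (Eventually.of_forall fun _ => zero_le) ?_
  filter_upwards [hs, hb] with T h1 h2
  rw [ENNReal.ofReal_div_of_pos h1]
  calc μ {ω | s T ≤ X T ω} ≤ μ {ω | ENNReal.ofReal (s T) ≤ ENNReal.ofReal (X T ω)} :=
        measure_mono fun ω hω => ENNReal.ofReal_le_ofReal hω
    _ ≤ (∫⁻ ω, ENNReal.ofReal (X T ω) ∂μ) / ENNReal.ofReal (s T) :=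
        meas_ge_le_lintegral_div (hX T).ennreal_ofReal.aemeasurable
          (ENNReal.ofReal_pos.2 h1).ne' ENNReal.ofReal_ne_top
    _ ≤ _ := by gcongr

lemma lintegral_sum_Icc_le {X : ℕ → Ω → ℝ} (hX : ∀ n, Measurable (X n)) (hX0 : ∀ n ω, 0 ≤ X n ω)
    {c : ℝ} (h : ∀ n ≥ 1, ∫⁻ ω, ENNReal.ofReal (X n ω) ∂μ ≤ ENNReal.ofReal c) (m : ℕ) :
    ∫⁻ ω, ENNReal.ofReal (∑ n ∈ Finset.Icc 1 m, X n ω) ∂μ ≤ ENNReal.ofReal (m * c) := by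
  simp_rw [ENNReal.ofReal_sum_of_nonneg fun n _ => hX0 n _]
  rw [lintegral_finsetSum _ fun n _ => (hX n).ennreal_ofReal]
  refine (Finset.sum_le_sum fun n hn => h n (Finset.mem_Icc.1 hn).1).trans ?_
  simp [ENNReal.ofReal_mul]

/-- Markov's inequality over a deterministic number of messages: the mean total error divided by
`√T` is at most `ρ² φ / 2 ^ r`, which tends to `0`. -/
lemma tendsto_measure_quantError {d φ : ℝ → ℝ} {r : ℝ → ℕ} {X : ℝ → ℕ → Ω → ℝ}
    (hX : ∀ T n, Measurable (X T n)) (hX0 : ∀ T n ω, 0 ≤ X T n ω)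
    (hd : ∀ᶠ T in atTop, 0 < d T) (hφ : ∀ᶠ T in atTop, 0 < φ T)
    (hdo : d =o[atTop] fun T => √T)
    (hgrowth : ∀ ε > 0, φ =O[atTop] fun T => (2 : ℝ) ^ (ε * (r T : ℝ)))
    (hr : (fun T => Real.log (√T / d T)) =o[atTop] fun T => (r T : ℝ))
    (h : ∀ᶠ T in atTop, ∀ n ≥ 1,
      ∫⁻ ω, ENNReal.ofReal (X T n ω) ∂μ ≤ ENNReal.ofReal (φ T / 2 ^ r T))
    {η : ℝ} (hη : 0 < η) :
    Tendsto (fun T => μ {ω | η * √T ≤ ∑ n ∈ Finset.Icc 1 ⌊(√T / d T) ^ 2 * √T⌋₊, X T n ω})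
      atTop (𝓝 0) := by
  have hlim := (tendsto_sq_mul_range_div_pow hd hφ hdo hgrowth hr).div_const η
  rw [zero_div] at hlim
  refine tendsto_measure_le_of_lintegral_le
    (b := fun T => (√T / d T) ^ 2 * √T * (φ T / 2 ^ r T))
    (fun T => Finset.measurable_fun_sum _ fun n _ => hX T n) ?_ ?_ (hlim.congr' ?_)
  · filter_upwards [eventually_gt_atTop 0] with T hT
    have := Real.sqrt_pos.2 hT
    positivity
  · filter_upwards [h, hφ] with T h1 h2
    refine (lintegral_sum_Icc_le (hX T) (hX0 T) h1 _).trans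
      (ENNReal.ofReal_le_ofReal ?_)
    gcongr
    exact Nat.floor_le (by positivity)
  · filter_upwards [eventually_gt_atTop 0] with T hT
    have := Real.sqrt_pos.2 hT
    field_simp

lemma lintegral_gaussian_abs_lt_top : ∫⁻ z, ENNReal.ofReal |z| ∂(gaussianReal 0 1) < ∞ := by
  have h1 : Integrable (fun z : ℝ => z) (gaussianReal 0 1) :=
    (memLp_id_gaussianReal 1).integrable (by simp)
  have := h1.hasFiniteIntegral
  rwa [hasFiniteIntegral_iff_norm] at this

lemma tendsto_measure_sqrt_le_abs {G : ℝ → Ω → ℝ} (hG : ∀ T, Measurable (G T))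
    (hlaw : ∀ᶠ T in atTop, μ.map (G T) = gaussianReal 0 1) :
    Tendsto (fun T => μ {ω | √T ≤ |G T ω|}) atTop (𝓝 0) := by
  refine tendsto_measure_le_of_lintegral_le
    (b := fun _ => (∫⁻ z, ENNReal.ofReal |z| ∂(gaussianReal 0 1)).toReal)
    (fun T => (measurable_norm.comp (hG T) : Measurable fun ω => ‖G T ω‖)) ?_ ?_ ?_
  · filter_upwards [eventually_gt_atTop 0] with T hT
    exact Real.sqrt_pos.2 hT
  · filter_upwards [hlaw] with T hT
    have hm : Measurable fun z : ℝ => ENNReal.ofReal |z| :=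
      (measurable_norm : Measurable fun z : ℝ => ‖z‖).ennreal_ofReal
    rw [ENNReal.ofReal_toReal lintegral_gaussian_abs_lt_top.ne, ← hT, lintegral_map hm (hG T)]
  · exact Real.tendsto_sqrt_atTop.const_div_atTop _

lemma lintegral_complexGaussian_norm_sq_lt_top (v : ℝ) :
    ∫⁻ z, ENNReal.ofReal (‖z‖ ^ 2) ∂(complexGaussian v) < ∞ := by
  have hm : Measurable fun p : ℝ × ℝ => (⟨p.1, p.2⟩ : ℂ) :=
    Complex.measurableEquivRealProd.symm.measurable
  have hn : Measurable fun z : ℂ => ENNReal.ofReal (‖z‖ ^ 2) :=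
    (measurable_norm.pow_const 2).ennreal_ofReal
  rw [complexGaussian, lintegral_map hn hm]
  set γ := gaussianReal 0 (v / 2).toNNReal
  have h1 : Integrable (fun z : ℝ => z ^ 2) γ := (memLp_id_gaussianReal 2).integrable_sq
  have h2 : Integrable (fun p : ℝ × ℝ => p.1 ^ 2 + p.2 ^ 2) (γ.prod γ) :=
    (h1.comp_fst γ).add (h1.comp_snd γ)
  have h3 := h2.hasFiniteIntegral
  rw [hasFiniteIntegral_iff_ofReal (Eventually.of_forall fun p => by positivity)] at h3
  refine lt_of_eq_of_lt (lintegral_congr fun p => ?_) h3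
  rw [Complex.sq_norm, Complex.normSq_apply]
  ring_nf

lemma integrable_of_first_increment [IsProbabilityMeasure μ] {e θ v : ℝ} {r : ℕ} {h : Ω → ℕ → ℂ}
    (hv : 0 ≤ v) (hh_meas : ∀ i, Measurable fun ω => h ω i) (hθ : 0 ≤ θ)
    (hint : ∫⁻ ω, ENNReal.ofReal |midRiser θ r (overU e (info v (h ω)) 1)
      - overU e (info v (h ω)) 1| ∂μ ≠ ∞) :
    Integrable (fun ω => 2 * ‖h ω 0‖ ^ 2 / v) μ := by
  have hm : Measurable fun ω => |midRiser θ r (overU e (info v (h ω)) 1)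
      - overU e (info v (h ω)) 1| :=
    measurable_abs_quantErrorU_term e θ r (fun t => measurable_info v hh_meas t) 1
  have h1 : Integrable (fun ω => |midRiser θ r (overU e (info v (h ω)) 1)
      - overU e (info v (h ω)) 1|) μ :=
    ⟨hm.aestronglyMeasurable, by
      rw [hasFiniteIntegral_iff_ofReal (Eventually.of_forall fun _ => abs_nonneg _)]
      exact lt_top_iff_ne_top.2 hint⟩
  refine ((integrable_const (e + θ)).add h1).mono'
    ((((hh_meas 0).norm.pow_const 2).const_mul 2).div_const v).aestronglyMeasurable
    (Eventually.of_forall fun ω => ?_)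
  rw [Real.norm_of_nonneg (by positivity)]
  have := first_increment_le (e := e) hθ r (info_zero v (h ω))
  simpa [info] using this

lemma tendsto_info_div [IsProbabilityMeasure μ] {v : ℝ} {h : Ω → ℕ → ℂ}
    (hh_indep : iIndepFun (fun (i : ℕ) ω => h ω i) μ)
    (hh_ident : ∀ i, IdentDistrib (fun ω => h ω i) (fun ω => h ω 0) μ μ)
    (hint : Integrable (fun ω => 2 * ‖h ω 0‖ ^ 2 / v) μ) :
    ∀ᵐ ω ∂μ, Tendsto (fun n : ℕ => info v (h ω) n / n) atTop
      (𝓝 (∫ ω, 2 * ‖h ω 0‖ ^ 2 / v ∂μ)) := by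
  have hf : Measurable fun z : ℂ => 2 * ‖z‖ ^ 2 / v :=
    ((measurable_norm.pow_const 2).const_mul 2).div_const v
  exact strong_law_ae_real (fun i ω => 2 * ‖h ω i‖ ^ 2 / v) hint
    (fun i j hij => (hh_indep.indepFun hij).comp hf hf) (fun i => (hh_ident i).comp hf)

lemma integral_info_pos {v : ℝ} (hv : 0 < v) {g : Ω → ℂ} [IsProbabilityMeasure μ]
    (hg : ∀ᵐ ω ∂μ, g ω ≠ 0) (hint : Integrable (fun ω => 2 * ‖g ω‖ ^ 2 / v) μ) :
    0 < ∫ ω, 2 * ‖g ω‖ ^ 2 / v ∂μ := by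
  rw [integral_pos_iff_support_of_nonneg (fun ω => by positivity) hint]
  have : Function.support (fun ω => 2 * ‖g ω‖ ^ 2 / v) =ᵐ[μ] Set.univ := by
    refine eventuallyEq_univ.2 (hg.mono fun ω hω => ?_)
    have := norm_pos_iff.2 hω
    have : 0 < 2 * ‖g ω‖ ^ 2 / v := by positivity
    exact this.ne'
  rw [measure_congr this]
  simp

/-- At a time of at least `4 T / c`, information below `2 T` means a time average of at most `c /
2`, which is far from the limit `c`. -/
lemma tendsto_measure_info_lt [IsProbabilityMeasure μ] {v c : ℝ} (hc : 0 < c) {h : Ω → ℕ → ℂ}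
    (hh_meas : ∀ i, Measurable fun ω => h ω i)
    (hlim : ∀ᵐ ω ∂μ, Tendsto (fun n : ℕ => info v (h ω) n / n) atTop (𝓝 c)) :
    Tendsto (fun T : ℝ => μ {ω | info v (h ω) ⌈4 / c * T⌉₊ < 2 * T}) atTop (𝓝 0) := by
  have h1 := tendstoInMeasure_iff_dist.1 (tendstoInMeasure_of_tendsto_ae
    (fun n => ((measurable_info v hh_meas n).div_const _).aestronglyMeasurable) hlim)
    (c / 2) (by positivity)
  have h2 : Tendsto (fun T : ℝ => ⌈4 / c * T⌉₊) atTop atTop :=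
    tendsto_nat_ceil_atTop.comp (tendsto_id.const_mul_atTop (by positivity))
  refine tendsto_of_tendsto_of_tendsto_of_le_of_le' tendsto_const_nhds (h1.comp h2)
    (Eventually.of_forall fun _ => zero_le) ?_
  filter_upwards [eventually_gt_atTop 0] with T hT
  refine measure_mono fun ω hω => ?_
  have hω : info v (h ω) ⌈4 / c * T⌉₊ < 2 * T := hω
  show c / 2 ≤ dist _ _
  have h3 : 4 / c * T ≤ (⌈4 / c * T⌉₊ : ℝ) := Nat.le_ceil _
  have h4 : (0 : ℝ) < ⌈4 / c * T⌉₊ := lt_of_lt_of_le (by positivity) h3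
  have h5 : info v (h ω) ⌈4 / c * T⌉₊ / (⌈4 / c * T⌉₊ : ℝ) ≤ c / 2 := by
    rw [div_le_iff₀ h4]
    refine hω.le.trans ?_
    calc 2 * T = c / 2 * (4 / c * T) := by field_simp; norm_num
      _ ≤ _ := by gcongr
  rw [dist_comm, Real.dist_eq]
  exact le_trans (by linarith) (le_abs_self _)

/-- The mean of the bound is `O(T)`, so Markov's inequality suffices against `T * ρ T` for any `ρ →
∞`; only the marginal laws matter. -/
lemma tendsto_measure_variationBound [IsProbabilityMeasure μ] {b v : ℝ} (hb : 0 ≤ b) (hv : 0 < v)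
    {h w : Ω → ℕ → ℂ}
    (hh_meas : ∀ i, Measurable fun ω => h ω i) (hw_meas : ∀ i, Measurable fun ω => w ω i)
    (hh_ident : ∀ i, IdentDistrib (fun ω => h ω i) (fun ω => h ω 0) μ μ)
    (hint : Integrable (fun ω => 2 * ‖h ω 0‖ ^ 2 / v) μ)
    (hw_law : ∀ i, μ.map (fun ω => w ω i) = complexGaussian v)
    {a : ℝ} (ha : 0 < a) {ρ : ℝ → ℝ} (hρ : Tendsto ρ atTop atTop) :
    Tendsto (fun T : ℝ => μ {ω | T * ρ T ≤ variationBound b v (h ω) (w ω) ⌈a * T⌉₊})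
      atTop (𝓝 0) := by
  have hf : Measurable fun z : ℂ => ENNReal.ofReal ((b + 1) * (2 * ‖z‖ ^ 2 / v)) :=
    ((((measurable_norm.pow_const 2).const_mul 2).div_const v).const_mul _).ennreal_ofReal
  have hg : Measurable fun z : ℂ => ENNReal.ofReal (‖z‖ ^ 2 / v) :=
    ((measurable_norm.pow_const 2).div_const v).ennreal_ofReal
  obtain ⟨A, hA⟩ : ∃ A : ℝ≥0∞, A = ∫⁻ ω, ENNReal.ofReal ((b + 1) * (2 * ‖h ω 0‖ ^ 2 / v)) ∂μ :=
    ⟨_, rfl⟩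
  obtain ⟨C, hC⟩ : ∃ C : ℝ≥0∞, C = ∫⁻ z, ENNReal.ofReal (‖z‖ ^ 2 / v) ∂(complexGaussian v) :=
    ⟨_, rfl⟩
  have hAtop : A ≠ ∞ := by
    have := (hint.const_mul (b + 1)).hasFiniteIntegral
    rw [hasFiniteIntegral_iff_ofReal (Eventually.of_forall fun _ => by positivity)] at this
    rw [hA]
    exact this.ne
  have hCtop : C ≠ ∞ := by
    rw [hC]
    simp_rw [ENNReal.ofReal_div_of_pos hv, div_eq_mul_inv]
    rw [lintegral_mul_const _ (measurable_norm.pow_const 2).ennreal_ofReal]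
    exact ENNReal.mul_ne_top (lintegral_complexGaussian_norm_sq_lt_top v).ne
      (by simpa using hv)
  have hterm : ∀ i, ∫⁻ ω, ENNReal.ofReal ((b + 1) * (2 * ‖h ω i‖ ^ 2 / v) + ‖w ω i‖ ^ 2 / v) ∂μ
      = A + C := by
    intro i
    have h1 : ∀ ω, ENNReal.ofReal ((b + 1) * (2 * ‖h ω i‖ ^ 2 / v) + ‖w ω i‖ ^ 2 / v) =
        ENNReal.ofReal ((b + 1) * (2 * ‖h ω i‖ ^ 2 / v)) + ENNReal.ofReal (‖w ω i‖ ^ 2 / v) :=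
      fun ω => ENNReal.ofReal_add (by positivity) (by positivity)
    simp_rw [h1]
    have hfi : Measurable fun ω => ENNReal.ofReal ((b + 1) * (2 * ‖h ω i‖ ^ 2 / v)) :=
      hf.comp (hh_meas i)
    rw [lintegral_add_left hfi]
    congr 1
    · rw [hA]
      exact ((hh_ident i).comp hf).lintegral_eq
    · rw [hC, ← hw_law i, lintegral_map hg (hw_meas i)]
  have hmeas : ∀ N, Measurable fun ω => variationBound b v (h ω) (w ω) N := fun N =>
    Finset.measurable_fun_sum _ fun i _ =>
      (((((hh_meas i).norm.pow_const 2).const_mul 2).div_const v).const_mul _).add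
        (((hw_meas i).norm.pow_const 2).div_const v)
  refine tendsto_measure_le_of_lintegral_le (b := fun T => (a * T + 1) * (A + C).toReal)
    (fun T => hmeas _) ?_ ?_ ?_
  · filter_upwards [eventually_gt_atTop 0, hρ.eventually_gt_atTop 0] with T h1 h2
    positivity
  · filter_upwards [eventually_ge_atTop 0] with T hT
    have h1 : ∀ ω, ENNReal.ofReal (variationBound b v (h ω) (w ω) ⌈a * T⌉₊) =
        ∑ i ∈ Finset.range ⌈a * T⌉₊,
          ENNReal.ofReal ((b + 1) * (2 * ‖h ω i‖ ^ 2 / v) + ‖w ω i‖ ^ 2 / v) := fun ω =>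
      ENNReal.ofReal_sum_of_nonneg fun i _ => by positivity
    simp_rw [h1]
    rw [lintegral_finsetSum _ fun i _ => ?_]
    · simp_rw [hterm]
      rw [Finset.sum_const, Finset.card_range, nsmul_eq_mul, ENNReal.ofReal_mul (by positivity),
        ENNReal.ofReal_toReal (ENNReal.add_ne_top.2 ⟨hAtop, hCtop⟩)]
      gcongr
      rw [← ENNReal.ofReal_natCast]
      exact ENNReal.ofReal_le_ofReal (Nat.ceil_lt_add_one (by positivity)).le
    · exact ((((((hh_meas i).norm.pow_const 2).const_mul 2).div_const v).const_mul _).add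
        (((hw_meas i).norm.pow_const 2).div_const v)).ennreal_ofReal
  · have h1 : Tendsto (fun T : ℝ => (a + 1) * (A + C).toReal / ρ T) atTop (𝓝 0) :=
      hρ.const_div_atTop _
    refine squeeze_zero' ?_ ?_ h1
    · filter_upwards [eventually_gt_atTop 0, hρ.eventually_gt_atTop 0] with T h1 h2
      positivity
    · filter_upwards [eventually_ge_atTop 1, hρ.eventually_gt_atTop 0] with T h1 h2
      have hT : 0 < T := by linarith
      rw [div_le_div_iff₀ (by positivity) h2]
      calc (a * T + 1) * (A + C).toReal * ρ T ≤ ((a + 1) * T) * (A + C).toReal * ρ T := by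
            gcongr; linarith
        _ = _ := by ring

end Probability

/-! ### Slutsky arguments, unconditional and conditional -/

section Transfer

variable {Ω : Type*} [mΩ : MeasurableSpace Ω] {μ : Measure Ω} [IsProbabilityMeasure μ]

lemma tendstoInDistribution_of_map_eq {γ : Measure ℝ} [IsProbabilityMeasure γ] {G : ℝ → Ω → ℝ}
    (hG : ∀ T, Measurable (G T)) (hlaw : ∀ᶠ T in atTop, μ.map (G T) = γ) :
    TendstoInDistribution G atTop (id : ℝ → ℝ) (fun _ => μ) γ where
  forall_aemeasurable := fun T => (hG T).aemeasurable
  aemeasurable_limit := aemeasurable_id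
  tendsto := by
    refine tendsto_const_nhds.congr' ?_
    filter_upwards [hlaw] with T hT
    apply Subtype.ext
    simp [hT]

lemma tendstoInDistribution_of_sub {γ : Measure ℝ} [IsProbabilityMeasure γ] {Z G : ℝ → Ω → ℝ}
    (hZ : ∀ T, Measurable (Z T)) (hG : ∀ T, Measurable (G T))
    (hlaw : ∀ᶠ T in atTop, μ.map (G T) = γ)
    (hsub : TendstoInMeasure μ (fun T ω => Z T ω - G T ω) atTop (fun _ => 0)) :
    TendstoInDistribution Z atTop (id : ℝ → ℝ) (fun _ => μ) γ := by
  have h1 := (tendstoInDistribution_of_map_eq hG hlaw).continuous_comp_prodMk_of_tendstoInMeasure_const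
    (g := fun p : ℝ × ℝ => p.1 + p.2) (by fun_prop) hsub
    (fun T => ((hZ T).sub (hG T)).aemeasurable)
  simpa [Function.id_def] using h1

lemma tendsto_integral_abs_comp_sub {γ : Measure ℝ} [IsProbabilityMeasure γ] {Z G : ℝ → Ω → ℝ}
    (hZ : ∀ T, Measurable (Z T)) (hG : ∀ T, Measurable (G T))
    (hlaw : ∀ᶠ T in atTop, μ.map (G T) = γ)
    (hsub : TendstoInMeasure μ (fun T ω => Z T ω - G T ω) atTop (fun _ => 0)) (f : ℝ →ᵇ ℝ) :
    Tendsto (fun T => ∫ ω, |f (Z T ω) - f (G T ω)| ∂μ) atTop (𝓝 0) := by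
  have h1 := (tendstoInDistribution_of_map_eq hG hlaw).prodMk_of_tendstoInMeasure_const
    G _ _ hsub (fun T => ((hZ T).sub (hG T)).aemeasurable)
  have h2 := ProbabilityMeasure.tendsto_iff_forall_integral_tendsto.1 h1.tendsto
  -- As `f` need not be uniformly continuous, the joint convergence of `(G, Z - G)` is tested
  -- against this function, which vanishes where the second coordinate is `0`.
  set Ψ : ℝ × ℝ →ᵇ ℝ := BoundedContinuousFunction.ofNormedAddCommGroup
    (fun p => |f (p.1 + p.2) - f p.1|) (by fun_prop) (2 * ‖f‖) (fun p => by
      rw [Real.norm_eq_abs, abs_abs]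
      refine (abs_sub _ _).trans ?_
      have := f.norm_coe_le_norm (p.1 + p.2)
      have := f.norm_coe_le_norm p.1
      simp only [Real.norm_eq_abs] at *
      linarith)
  have h3 := h2 Ψ
  have hΨ : StronglyMeasurable Ψ := Ψ.continuous.stronglyMeasurable
  have hm : ∀ T, Measurable fun ω => (G T ω, Z T ω - G T ω) := fun T =>
    (hG T).prodMk ((hZ T).sub (hG T))
  have h4 : ∀ T, ∫ p, Ψ p ∂(μ.map fun ω => (G T ω, Z T ω - G T ω)) =
      ∫ ω, |f (Z T ω) - f (G T ω)| ∂μ := fun T => by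
    rw [integral_map (hm T).aemeasurable hΨ.aestronglyMeasurable]
    simp [Ψ]
  have h5 : ∫ p, Ψ p ∂(γ.map fun z => (id z, (0 : ℝ))) = 0 := by
    rw [integral_map (measurable_id.prodMk measurable_const).aemeasurable hΨ.aestronglyMeasurable]
    simp [Ψ]
  simp only [ProbabilityMeasure.coe_mk, h4, h5] at h3
  exact h3

/-- Independence gives `f(G)` the conditional expectation `∫ f dγ`. The deviation is thus the
conditional expectation of `f(Z) - f(G)`, whose `L¹` norm is at most that of `f(Z) - f(G)` itself.
This works for any sub-σ-algebra of that of `h`, even one varying with `T`. -/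
lemma tendstoInMeasure_condExp {γ : Measure ℝ} [IsProbabilityMeasure γ] {β : Type*}
    [MeasurableSpace β] {h : Ω → β} (hh : Measurable h) {Z G : ℝ → Ω → ℝ}
    (hZ : ∀ T, Measurable (Z T)) (hG : ∀ T, Measurable (G T))
    (hlaw : ∀ᶠ T in atTop, μ.map (fun ω => (h ω, G T ω)) = (μ.map h).prod γ)
    (hsub : TendstoInMeasure μ (fun T ω => Z T ω - G T ω) atTop (fun _ => 0))
    {m : ℝ → MeasurableSpace Ω} (hm : ∀ T, m T ≤ MeasurableSpace.comap h inferInstance)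
    (f : ℝ →ᵇ ℝ) :
    TendstoInMeasure μ (fun T => μ[fun ω => f (Z T ω) | m T]) atTop (fun _ => ∫ z, f z ∂γ) := by
  have hle : ∀ T, m T ≤ mΩ := fun T => (hm T).trans hh.comap_le
  have : IsProbabilityMeasure (μ.map h) := Measure.isProbabilityMeasure_map hh.aemeasurable
  have hlawG : ∀ᶠ T in atTop, μ.map (G T) = γ := by
    filter_upwards [hlaw] with T hT
    have h1 : μ.map (G T) = (μ.map (fun ω => (h ω, G T ω))).map Prod.snd := by
      rw [Measure.map_map measurable_snd (hh.prodMk (hG T))]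
      rfl
    rw [h1, hT]
    exact measurePreserving_snd.map_eq
  have hfint : ∀ {X : Ω → ℝ}, Measurable X → Integrable (fun ω => f (X ω)) μ := fun hX =>
    Integrable.of_bound (f.continuous.measurable.comp hX).aestronglyMeasurable ‖f‖
      (Eventually.of_forall fun ω => f.norm_coe_le_norm _)
  refine tendstoInMeasure_of_tendsto_eLpNorm (p := 1) one_ne_zero
    (fun T => (stronglyMeasurable_condExp.mono (hle T)).aestronglyMeasurable)
    aestronglyMeasurable_const ?_
  have hL1 := tendsto_integral_abs_comp_sub hZ hG hlawG hsub f
  have h0 : Tendsto (fun T => ENNReal.ofReal (∫ ω, |f (Z T ω) - f (G T ω)| ∂μ)) atTop (𝓝 0) := by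
    simpa using ENNReal.tendsto_ofReal hL1
  refine tendsto_of_tendsto_of_tendsto_of_le_of_le' tendsto_const_nhds h0
    (Eventually.of_forall fun _ => zero_le) ?_
  filter_upwards [hlaw, hlawG] with T hT hTG
  have hind : IndepFun h (G T) μ := by
    rw [indepFun_iff_map_prod_eq_prod_map_map hh.aemeasurable (hG T).aemeasurable, hT, hTG]
  have hcond : μ[fun ω => f (G T ω) | m T] =ᵐ[μ] fun _ => ∫ z, f z ∂γ := by
    have h1 : StronglyMeasurable[MeasurableSpace.comap (G T) inferInstance] fun ω => f (G T ω) :=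
      f.continuous.stronglyMeasurable.comp_measurable (comap_measurable (G T))
    have h2 : Indep (MeasurableSpace.comap (G T) inferInstance) (m T) μ :=
      indep_of_indep_of_le_right hind.symm (hm T)
    refine (condExp_indep_eq (hG T).comap_le (hle T) h1 h2).trans (Eventually.of_forall fun _ => ?_)
    simp only
    rw [← hTG, integral_map (hG T).aemeasurable f.continuous.stronglyMeasurable.aestronglyMeasurable]
  have hsubc : (μ[fun ω => f (Z T ω) | m T] - fun _ => ∫ z, f z ∂γ) =ᵐ[μ]
      μ[(fun ω => f (Z T ω)) - (fun ω => f (G T ω)) | m T] := by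
    filter_upwards [condExp_sub (hfint (hZ T)) (hfint (hG T)) (m T), hcond] with ω h1 h2
    rw [h1, Pi.sub_apply, Pi.sub_apply, h2]
  rw [eLpNorm_congr_ae hsubc]
  refine (eLpNorm_condExp_le_eLpNorm _ le_rfl).trans (le_of_eq ?_)
  have hint : Integrable (fun ω => |f (Z T ω) - f (G T ω)|) μ :=
    ((hfint (hZ T)).sub (hfint (hG T))).abs
  rw [eLpNorm_one_eq_lintegral_enorm, ofReal_integral_eq_lintegral_ofReal hint
    (Eventually.of_forall fun _ => abs_nonneg _)]
  refine lintegral_congr fun ω => ?_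
  rw [← ofReal_norm]
  rfl

end Transfer

/-! ### Assembling the bad events -/

section Main

variable {Ω : Type*} [MeasurableSpace Ω] {μ : Measure Ω} {K : ℕ}

lemma exists_le_fusionU {D : Design K} {σ : Fin K → ℝ} {h : Fin K → ℕ → ℂ}
    (he : ∀ k, 0 < D.e k) (hθ : ∀ k, 0 ≤ D.θ k) (k : Fin K)
    (hinfo : Tendsto (info (σ k ^ 2) (h k)) atTop atTop) (T : ℝ) :
    ∃ t, T ≤ fusionU D σ h t := by
  obtain ⟨t, ht⟩ := exists_le_numMessages (e := D.e k) hinfo ⌈T / D.e k⌉₊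
  refine ⟨t, le_trans ?_ (mul_numMessages_le_fusionU he hθ k t)⟩
  rw [mul_comm, ← div_le_iff₀ (he k)]
  exact (Nat.le_ceil _).trans (by exact_mod_cast ht)

lemma tendsto_atTop_of_tendsto_div {u : ℕ → ℝ} {c : ℝ} (hc : 0 < c)
    (hu : Tendsto (fun n : ℕ => u n / n) atTop (𝓝 c)) : Tendsto u atTop atTop := by
  refine (hu.pos_mul_atTop hc tendsto_natCast_atTop_atTop).congr' ?_
  filter_upwards [eventually_gt_atTop 0] with n hn
  have : (n : ℝ) ≠ 0 := by positivity
  field_simp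

/-- Off finitely many events of vanishing probability the deterministic comparison applies, with a
bound proportional to `η`; choosing `η` small in terms of `ε` finishes. -/
lemma tendstoInMeasure_normalizedError_sub (x : ℂ) (σ : Fin K → ℝ) (h w : Ω → Fin K → ℕ → ℂ)
    (D : ℝ → Design K) (N : ℝ → ℕ)
    (hd : ∀ᶠ T in atTop, ∀ k, 0 < (D T).d k) (he : ∀ᶠ T in atTop, ∀ k, 0 < (D T).e k)
    (hθ : ∀ᶠ T in atTop, ∀ k, 0 < (D T).θ k)
    (hdo : ∀ k, (fun T => (D T).d k) =o[atTop] fun T => √T)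
    (heo : ∀ k, (fun T => (D T).e k) =o[atTop] fun T => √T)
    (hU : ∀ η > 0, ∀ k, Tendsto (fun T => μ {ω | η * √T ≤
      quantErrorU ((D T).e k) ((D T).θ k) (D T).rU (info (σ k ^ 2) (h ω k))
        ⌊(√T / (D T).e k) ^ 2 * √T⌋₊}) atTop (𝓝 0))
    (hV : ∀ η > 0, ∀ k, Tendsto (fun T => μ {ω | η * √T ≤
      quantErrorV ((D T).d k) ((D T).φ k) (D T).rV
        (corr (σ k ^ 2) (h ω k) (observe x (h ω) (w ω) k))
        ⌊(√T / (D T).d k) ^ 2 * √T⌋₊}) atTop (𝓝 0))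
    (hN : Tendsto (fun T => μ {ω | fisherInfo σ (h ω) (N T) < 2 * T}) atTop (𝓝 0))
    (hY : ∀ k, Tendsto (fun T => μ {ω | T * (√T / (D T).d k) ≤
      variationBound |x.re| (σ k ^ 2) (h ω k) (w ω k) (N T)}) atTop (𝓝 0))
    (hG : Tendsto (fun T => μ {ω | √T ≤ |normalizedScore (D T) σ T (h ω) (w ω)|}) atTop (𝓝 0))
    (hreach : ∀ᶠ T in atTop, ∀ᵐ ω ∂μ, ∃ t, T ≤ fusionU (D T) σ (h ω) t)
    (hpos : ∀ᶠ T in atTop, ∀ᵐ ω ∂μ, 0 < fisherInfo σ (h ω) (stopTime (D T) σ T (h ω))) :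
    TendstoInMeasure μ (fun T ω => normalizedError (D T) σ T x (h ω) (w ω)
      - normalizedScore (D T) σ T (h ω) (w ω)) atTop (fun _ => 0) := by
  rw [tendstoInMeasure_iff_norm]
  intro ε hε
  obtain ⟨η, hη, hηε⟩ : ∃ η : ℝ, 0 < η ∧ (3 + 2 * |x.re|) * (2 * K * η) < ε := by
    have h1 : Tendsto (fun η : ℝ => (3 + 2 * |x.re|) * (2 * K * η)) (𝓝[>] 0) (𝓝 0) := by
      have : Continuous fun η : ℝ => (3 + 2 * |x.re|) * (2 * K * η) := by fun_prop
      have h2 := this.tendsto 0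
      simp only [mul_zero] at h2
      exact h2.mono_left nhdsWithin_le_nhds
    obtain ⟨η, h3, h4⟩ := ((h1.eventually (gt_mem_nhds hε)).and self_mem_nhdsWithin).exists
    exact ⟨η, h4, h3⟩
  set bU : Fin K → ℝ → Set Ω := fun k T => {ω | η * √T ≤
      quantErrorU ((D T).e k) ((D T).θ k) (D T).rU (info (σ k ^ 2) (h ω k))
        ⌊(√T / (D T).e k) ^ 2 * √T⌋₊} with hbU
  set bV : Fin K → ℝ → Set Ω := fun k T => {ω | η * √T ≤
      quantErrorV ((D T).d k) ((D T).φ k) (D T).rV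
        (corr (σ k ^ 2) (h ω k) (observe x (h ω) (w ω) k))
        ⌊(√T / (D T).d k) ^ 2 * √T⌋₊} with hbV
  set bN : ℝ → Set Ω := fun T => {ω | fisherInfo σ (h ω) (N T) < 2 * T} with hbN
  set bY : Fin K → ℝ → Set Ω := fun k T => {ω | T * (√T / (D T).d k) ≤
      variationBound |x.re| (σ k ^ 2) (h ω k) (w ω k) (N T)} with hbY
  set bG : ℝ → Set Ω := fun T => {ω | √T ≤ |normalizedScore (D T) σ T (h ω) (w ω)|} with hbG
  have hlim : Tendsto (fun T => ∑ k, (μ (bU k T) + μ (bV k T) + μ (bY k T))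
      + (μ (bN T) + μ (bG T))) atTop (𝓝 0) := by
    have h1 : Tendsto (fun T => ∑ k, (μ (bU k T) + μ (bV k T) + μ (bY k T))) atTop
        (𝓝 (∑ _k : Fin K, (0 + 0 + 0))) :=
      tendsto_finsetSum _ fun k _ => ((hU η hη k).add (hV η hη k)).add (hY k)
    have h2 := h1.add (hN.add hG)
    simpa using h2
  refine tendsto_of_tendsto_of_tendsto_of_le_of_le' tendsto_const_nhds hlim
    (Eventually.of_forall fun _ => zero_le) ?_
  -- With `ρ ≥ 2` and `√T ≥ 1`, `√T ρ + 1 ≤ ρ² √T - 1`. So `⌊ρ² √T⌋` exceeds the count `T / e + 1`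
  -- despite the floor.
  have hρ : ∀ᶠ T in atTop, ∀ k, 2 ≤ √T / (D T).e k :=
    eventually_all.2 fun k => (tendsto_sqrt_div_atTop (he.mono fun T hT => hT k)
      (heo k)).eventually_ge_atTop 2
  have hdη : ∀ᶠ T in atTop, ∀ k, (D T).d k ≤ η * √T := eventually_all.2 fun k =>
    ((hdo k).bound hη).mono fun T hT => by
      rw [Real.norm_eq_abs, Real.norm_of_nonneg (Real.sqrt_nonneg T)] at hT
      exact (le_abs_self _).trans hT
  have heη : ∀ᶠ T in atTop, ∀ k, (D T).e k ≤ η * √T := eventually_all.2 fun k =>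
    ((heo k).bound hη).mono fun T hT => by
      rw [Real.norm_eq_abs, Real.norm_of_nonneg (Real.sqrt_nonneg T)] at hT
      exact (le_abs_self _).trans hT
  filter_upwards [hd, he, hθ, hρ, hdη, heη, hreach, hpos, eventually_gt_atTop 0,
    Real.tendsto_sqrt_atTop.eventually_ge_atTop (2 * K * η),
    Real.tendsto_sqrt_atTop.eventually_ge_atTop 1] with
    T hd he hθ hρ hdη heη hreach hpos hT hsqrt hsqrt2
  have hsub : ({ω | ε ≤ ‖normalizedError (D T) σ T x (h ω) (w ω)
      - normalizedScore (D T) σ T (h ω) (w ω) - 0‖} : Set Ω) ≤ᵐ[μ]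
      ((⋃ k, (bU k T ∪ bV k T ∪ bY k T)) ∪ (bN T ∪ bG T) : Set Ω) := by
    filter_upwards [hreach, hpos] with ω hs hp
    intro (hω : ε ≤ ‖_‖)
    show ω ∈ ((⋃ k, (bU k T ∪ bV k T ∪ bY k T)) ∪ (bN T ∪ bG T) : Set Ω)
    by_contra hbad
    simp only [Set.mem_union, Set.mem_iUnion, not_or, not_exists] at hbad
    obtain ⟨hk, hN', hG'⟩ := hbad
    have hTT : √T * √T = T := Real.mul_self_sqrt hT.le
    have key := abs_normalizedError_sub_normalizedScore_le (D := D T) (σ := σ) (T := T) (h := h ω)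
      (w := w ω) x hη.le hT (fun k => ⟨hd k, hdη k⟩) (fun k => ⟨he k, heη k⟩) (fun k => (hθ k).le)
      (m := fun k => ⌊(√T / (D T).e k) ^ 2 * √T⌋₊) (n := fun k => ⌊(√T / (D T).d k) ^ 2 * √T⌋₊)
      (N := N T) (fun k => ?_) ?_ (fun k => (not_le.1 (hk k).1.1).le)
      (fun k => (not_le.1 (hk k).1.2).le) (not_lt.1 hN') (fun k => ?_) hs hp (not_le.1 hG').le
    · rw [sub_zero, Real.norm_eq_abs] at hω
      linarith
    · have h1 : T / (D T).e k = √T * (√T / (D T).e k) := by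
        rw [← mul_div_assoc, hTT]
      have h2 := Nat.lt_floor_add_one ((√T / (D T).e k) ^ 2 * √T)
      rw [h1]
      have h3 := hρ k
      set ρ := √T / (D T).e k
      nlinarith [mul_nonneg (sub_nonneg.2 hsqrt2) (sub_nonneg.2 h3),
        mul_nonneg (mul_nonneg (sub_nonneg.2 h3) (sub_nonneg.2 h3)) (Real.sqrt_nonneg T)]
    · calc 2 * K * η * √T ≤ √T * √T := by gcongr
        _ = T := hTT
    -- The cap `⌊ρ² √T⌋` on `V` messages comes from here: `T ρ = d · (ρ² √T)` for `ρ = √T / d`.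
    · have h1 : variationBound |x.re| (σ k ^ 2) (h ω k) (w ω k) (N T) < T * (√T / (D T).d k) :=
        not_le.1 (hk k).2
      refine h1.trans_le ?_
      have h2 := (Nat.lt_floor_add_one ((√T / (D T).d k) ^ 2 * √T)).le
      have hdk := hd k
      calc T * (√T / (D T).d k) = √T * √T * (√T / (D T).d k) := by rw [hTT]
        _ = (D T).d k * ((√T / (D T).d k) ^ 2 * √T) := by field_simp
        _ ≤ _ := by gcongr
  refine (measure_mono_ae hsub).trans ((measure_union_le _ _).trans (add_le_add ?_ ?_))
  · refine (measure_iUnion_fintype_le μ _).trans (Finset.sum_le_sum fun k _ => ?_)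
    exact (measure_union_le _ _).trans (by gcongr; exact measure_union_le _ _)
  · exact measure_union_le _ _

end Main

end LevelTriggered

theorem theorem7 {Ω : Type*} [MeasurableSpace Ω] (μ : Measure Ω) [IsProbabilityMeasure μ]
    {K : ℕ} (hK : 0 < K)
    -- the parameter, the noise levels, the channel gains and the noise
    (x : ℂ) (σ : Fin K → ℝ) (hσ : ∀ k, 0 < σ k)
    (h w : Ω → Fin K → ℕ → ℂ)
    (hh_meas : ∀ k i, Measurable (fun ω => h ω k i))
    (hw_meas : ∀ k i, Measurable (fun ω => w ω k i))
    -- at each sensor the gains are i.i.d. across time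
    (hh_indep : ∀ k, iIndepFun (fun (i : ℕ) ω => h ω k i) μ)
    (hh_ident : ∀ k i, IdentDistrib (fun ω => h ω k i) (fun ω => h ω k 0) μ μ)
    -- the noise is complex Gaussian, independent across time and sensors, independent of the gains
    (hw_law : ∀ k i, μ.map (fun ω => w ω k i) = complexGaussian (σ k ^ 2))
    (hw_indep : iIndepFun (fun (p : Fin K × ℕ) ω => w ω p.1 p.2) μ)
    (hhw_indep : IndepFun h w μ)
    -- (A1) and (A2)
    (hA1 : x.re ≠ 0 ∧ x.im ≠ 0)
    (hA2 : ∀ k i, ∀ᵐ ω ∂μ, h ω k i ≠ 0)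
    -- the design parameters, as functions of the target Fisher information
    (D : ℝ → Design K)
    (hpos : ∀ᶠ T in atTop, ∀ k, 0 < (D T).d k ∧ 0 < (D T).φ k ∧ 0 < (D T).θ k)
    -- design of the quantizers
    (hφ : ∀ᶠ T in atTop, ∀ k, ∀ n ≥ 1,
      ∫⁻ ω, ENNReal.ofReal
        |midRiser ((D T).φ k) ((D T).rV - 1)
            (overV ((D T).d k) (corr (σ k ^ 2) (h ω k) (observe x (h ω) (w ω) k)) n)
          - overV ((D T).d k) (corr (σ k ^ 2) (h ω k) (observe x (h ω) (w ω) k)) n| ∂μ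
        ≤ ENNReal.ofReal ((D T).φ k / 2 ^ (D T).rV))
    (hθ : ∀ᶠ T in atTop, ∀ k, ∀ n ≥ 1,
      ∫⁻ ω, ENNReal.ofReal
        |midRiser ((D T).θ k) (D T).rU (overU ((D T).e k) (info (σ k ^ 2) (h ω k)) n)
          - overU ((D T).e k) (info (σ k ^ 2) (h ω k)) n| ∂μ
        ≤ ENNReal.ofReal ((D T).θ k / 2 ^ ((D T).rU + 1)))
    -- the quantizer ranges grow subexponentially in the number of bits
    (hφ_growth : ∀ k, ∀ ε > 0,
      (fun T => (D T).φ k) =O[atTop] fun T => (2 : ℝ) ^ (ε * ((D T).rV : ℝ)))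
    (hθ_growth : ∀ k, ∀ ε > 0,
      (fun T => (D T).θ k) =O[atTop] fun T => (2 : ℝ) ^ (ε * ((D T).rU : ℝ)))
    -- rates
    (hd : ∀ k, (fun T => (D T).d k) =o[atTop] fun T => √T)
    (hrV : ∀ k, (fun T => Real.log (√T / (D T).d k)) =o[atTop] fun T => ((D T).rV : ℝ))
    (he_top : ∀ k, Tendsto (fun T => (D T).e k) atTop atTop)
    (he : ∀ k, (fun T => (D T).e k) =o[atTop] fun T => √T)
    (hrU : ∀ k, (fun T => Real.log (√T / (D T).e k)) =o[atTop] fun T => ((D T).rU : ℝ)) :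
    -- the scheme stops almost surely
    (∀ᶠ T in atTop, ∀ᵐ ω ∂μ, ∃ t, T ≤ fusionU (D T) σ (h ω) t) ∧
    -- convergence in distribution to the standard Gaussian law
    TendstoInDistribution (fun (T : ℝ) ω => normalizedError (D T) σ T x (h ω) (w ω)) atTop
      (id : ℝ → ℝ) (fun _ => μ) (gaussianReal 0 1) ∧
    -- the same given the channel gains observed up to the stopping time
    (∀ f : ℝ →ᵇ ℝ, TendstoInMeasure μ
      (fun (T : ℝ) => μ[fun ω => f (normalizedError (D T) σ T x (h ω) (w ω)) |
        gainsUpToStop (D T) σ T h])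
      atTop (fun _ => ∫ z, f z ∂(gaussianReal 0 1))) := by
  have hv : ∀ k, 0 < σ k ^ 2 := fun k => pow_pos (hσ k) 2
  have hdpos : ∀ᶠ T in atTop, ∀ k, 0 < (D T).d k := hpos.mono fun T hT k => (hT k).1
  have hφpos : ∀ᶠ T in atTop, ∀ k, 0 < (D T).φ k := hpos.mono fun T hT k => (hT k).2.1
  have hθpos : ∀ᶠ T in atTop, ∀ k, 0 < (D T).θ k := hpos.mono fun T hT k => (hT k).2.2
  have hepos : ∀ᶠ T in atTop, ∀ k, 0 < (D T).e k :=
    eventually_all.2 fun k => (he_top k).eventually_gt_atTop 0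
  have hh : Measurable h := measurable_pi_lambda _ fun k => measurable_pi_lambda _ (hh_meas k)
  have hint : ∀ k, Integrable (fun ω => 2 * ‖h ω k 0‖ ^ 2 / σ k ^ 2) μ := fun k => by
    -- One admissible target suffices, because the law of the gains does not depend on it.
    obtain ⟨T, h1, h2⟩ := (hθ.and hθpos).exists
    exact integrable_of_first_increment (hv k).le (hh_meas k) (h2 k).le
      (ne_top_of_le_ne_top ENNReal.ofReal_ne_top (h1 k 1 le_rfl))
  have hcpos : ∀ k, 0 < ∫ ω, 2 * ‖h ω k 0‖ ^ 2 / σ k ^ 2 ∂μ := fun k =>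
    integral_info_pos (hv k) (hA2 k 0) (hint k)
  have hlln := fun k => tendsto_info_div (hh_indep k) (hh_ident k) (hint k)
  set k₀ : Fin K := ⟨0, hK⟩
  set c := ∫ ω, 2 * ‖h ω k₀ 0‖ ^ 2 / σ k₀ ^ 2 ∂μ with hc
  have hc0 : 0 < c := hcpos k₀
  have hreach : ∀ᶠ T in atTop, ∀ᵐ ω ∂μ, ∃ t, T ≤ fusionU (D T) σ (h ω) t := by
    filter_upwards [hepos, hθpos] with T h1 h2
    filter_upwards [hlln k₀] with ω hω
    exact exists_le_fusionU h1 (fun k => (h2 k).le) k₀ (tendsto_atTop_of_tendsto_div hc0 hω) T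
  have hfisher : ∀ᶠ T in atTop, ∀ᵐ ω ∂μ, 0 < fisherInfo σ (h ω) (stopTime (D T) σ T (h ω)) := by
    filter_upwards [hreach, eventually_gt_atTop 0] with T h1 hT
    filter_upwards [h1, hA2 k₀ 0] with ω h2 h3
    exact fisherInfo_pos hσ k₀ h3 (stopTime_pos hT h2)
  have hZ := fun T => measurable_normalizedError (D T) σ T x hh_meas hw_meas
  have hG := fun T => measurable_normalizedScore (D T) σ T hh_meas hw_meas
  have hprod : ∀ᶠ T in atTop,
      μ.map (fun ω => (h ω, normalizedScore (D T) σ T (h ω) (w ω))) =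
        (μ.map h).prod (gaussianReal 0 1) := hfisher.mono fun T hT =>
    map_gains_normalizedScore hσ hh_meas hw_meas hw_law hw_indep hhw_indep (D T) T hT
  have : IsProbabilityMeasure (μ.map h) := Measure.isProbabilityMeasure_map hh.aemeasurable
  have hlaw : ∀ᶠ T in atTop,
      μ.map (fun ω => normalizedScore (D T) σ T (h ω) (w ω)) = gaussianReal 0 1 := by
    filter_upwards [hprod] with T hT
    have h1 : μ.map (fun ω => normalizedScore (D T) σ T (h ω) (w ω)) =
        (μ.map (fun ω => (h ω, normalizedScore (D T) σ T (h ω) (w ω)))).map Prod.snd := by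
      rw [Measure.map_map measurable_snd (hh.prodMk (hG T))]
      rfl
    rw [h1, hT]
    exact measurePreserving_snd.map_eq
  have hobs := measurable_observe x hh_meas hw_meas
  have hsub : TendstoInMeasure μ (fun T ω => normalizedError (D T) σ T x (h ω) (w ω)
      - normalizedScore (D T) σ T (h ω) (w ω)) atTop (fun _ => 0) := by
    refine tendstoInMeasure_normalizedError_sub x σ h w D (fun T => ⌈4 / c * T⌉₊) hdpos hepos
      hθpos hd he (fun η hη k => ?_) (fun η hη k => ?_) ?_ (fun k => ?_)
      (tendsto_measure_sqrt_le_abs hG hlaw) hreach hfisher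
    · refine tendsto_measure_quantError
        (X := fun T n ω => |midRiser ((D T).θ k) (D T).rU (overU ((D T).e k)
          (info (σ k ^ 2) (h ω k)) n) - overU ((D T).e k) (info (σ k ^ 2) (h ω k)) n|)
        (fun T n => measurable_abs_quantErrorU_term _ _ _
          (fun t => measurable_info _ (hh_meas k) t) n) (fun _ _ _ => abs_nonneg _)
        (hepos.mono fun T hT => hT k) (hθpos.mono fun T hT => hT k) (he k) (hθ_growth k) (hrU k)
        ?_ hη
      filter_upwards [hθ, hθpos] with T h1 h2 n hn
      -- The extra factor `1 / 2` in the bound for `U` is given up, so that one rate lemma serves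
      -- both message types.
      refine (h1 k n hn).trans (ENNReal.ofReal_le_ofReal ?_)
      have := h2 k
      gcongr
      · norm_num
      · omega
    · refine tendsto_measure_quantError
        (X := fun T n ω => |midRiser ((D T).φ k) ((D T).rV - 1) (overV ((D T).d k)
          (corr (σ k ^ 2) (h ω k) (observe x (h ω) (w ω) k)) n)
          - overV ((D T).d k) (corr (σ k ^ 2) (h ω k) (observe x (h ω) (w ω) k)) n|)
        (fun T n => measurable_abs_quantErrorV_term _ _ _
          (fun t => measurable_corr _ (hh_meas k) (hobs k) t) n) (fun _ _ _ => abs_nonneg _)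
        (hdpos.mono fun T hT => hT k) (hφpos.mono fun T hT => hT k) (hd k) (hφ_growth k) (hrV k)
        ?_ hη
      filter_upwards [hφ] with T h1 n hn
      exact h1 k n hn
    -- A single sensor already accumulates the required information, so no joint law of the gains
    -- across sensors is needed.
    · refine tendsto_of_tendsto_of_tendsto_of_le_of_le tendsto_const_nhds
        (tendsto_measure_info_lt hc0 (hh_meas k₀) (hlln k₀)) (fun _ => zero_le) fun T => ?_
      refine measure_mono fun ω hω => ?_
      have h1 : info (σ k₀ ^ 2) (h ω k₀) ⌈4 / c * T⌉₊ ≤ fisherInfo σ (h ω) ⌈4 / c * T⌉₊ :=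
        Finset.single_le_sum (f := fun k => info (σ k ^ 2) (h ω k) ⌈4 / c * T⌉₊)
          (fun k _ => by unfold info; positivity) (Finset.mem_univ k₀)
      exact h1.trans_lt hω
    · exact tendsto_measure_variationBound (abs_nonneg _) (hv k) (hh_meas k) (hw_meas k)
        (hh_ident k) (hint k) (hw_law k) (by positivity)
        (tendsto_sqrt_div_atTop (hdpos.mono fun T hT => hT k) (hd k))
  exact ⟨hreach, tendstoInDistribution_of_sub hZ hG hlaw hsub, fun f =>
    tendstoInMeasure_condExp hh hZ hG hprod hsub
      (fun T => gainsUpToStop_le_comap (D T) σ T h) f⟩
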